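/- **Setting.** Let $V_{\mathbb R}$ be a Euclidean space of dimension $\ell$ and let $W\subset O(V_{\mathbb R})$ be a finite group generated by orthogonal reflections such that the $W$-module $V_{\mathbb R}$ is irreducible. Put $V=\mathbb C\otimes V_{\mathbb R}$, let $\mathcal S\subset W$ be the set of reflections, and let $\alpha_s$ be a root of $s\in\mathcal S$. Let $C_1,\dots,C_k$ be the conjugacy classes of $W$ contained in $\mathcal S$ and let $\mathbb C[c]=\mathbb C[c_1,\dots,c_k]$, with $c(s)=c_i$ for $s\in C_i$. For $y\in V^*$ the universal Dunkl operator $\nabla_y$ on $\mathbb C[c]\otimes S(V)$ is $$\nabla_y(q)=\frac{\partial q}{\partial y}-\sum_{s\in\mathcal S}c(s)\,\langle y,\alpha_s\rangle\,\frac{q-s(q)}{\alpha_s};$$ these operators commute, and $p\mapsto\nabla_p$, $p\in S(V^*)$, denotes the multiplicative extension of $y\mapsto\nabla_y$. A *system of basic invariants* is a family of $\ell$ algebraically independent elements $f_1,\dots,f_\ell$ with $S(V)^W=\mathbb C[f_1,\dots,f_\ell]$. The group $W$ has a system of homogeneous basic invariants (Chevalley); let $d_1\le\dots\le d_\ell$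 be their degrees. Let $e^{(c)}_{d_1},\dots,e^{(c)}_{d_\ell}\in\mathbb C[c]\otimes S(V)$ be a system of *canonical deformed invariants*: $e^{(c)}_{d_i}$ is $W$-invariant, homogeneous of degree $d_i$ with respect to $S(V)$, and $\nabla_p(e^{(c)}_{d_i})=0$ for every homogeneous $W$-invariant $p\in S(V^*)$ with $0<\deg p<d_i$; moreover $e^{(c)}_{d_1},\dots,e^{(c)}_{d_\ell}$ are linearly independent over $\mathbb C[c]$. (If the $d_i$ are distinct, linear independence just means that every $e^{(c)}_{d_i}$ is nonzero. If $d_i=d_{i+1}$, which happens only for $W=D_\ell$ with $\ell$ even, the two elements of degree $d_i$ can be, for example, a nonzero invariant and a nonzero skew-invariant of an involutive automorphism of $V$ that normalizes $W$.) **Theorem.** Systems of canonical deformed invariants exist. For every such system and for generic $c$, the specialized elements form a system of basic invariants of $W$: they are algebraically independent and $$S(V)^W=\mathbb C[e^{(c)}_{d_1},\dots,e^{(c)}_{d_\ell}].$$ Here "for generic $c$" means: there is a nonzero polynomial $F\in\mathbb C[c]$ (depending on $W$ and on the system) such that the assertion holds for all $c\in\mathbb C^k$ with $F(c)\ne0$.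 -/

import Mathlib

open MvPolynomial

noncomputable section

namespace DeformedInvariants

/-- The orthogonal group of the Euclidean space `ℝⁿ`. -/
abbrev OrthGroup (n : ℕ) := Matrix.orthogonalGroup (Fin n) ℝ

/-- `w` is the orthogonal reflection `v ↦ v - 2 (α, v) / (α, α) α` with root `α`. -/
def HasRoot {n : ℕ} (w : OrthGroup n) (α : Fin n → ℝ) : Prop :=
  α ≠ 0 ∧ w.1 = 1 - (2 / (α ⬝ᵥ α)) • Matrix.vecMulVec α α

/-- `w` is an orthogonal reflection. -/
def IsReflection {n : ℕ} (w : OrthGroup n) : Prop := ∃ α : Fin n → ℝ, HasRoot w α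

/-- `W` is generated by the reflections which it contains. -/
def IsReflectionGroup {n : ℕ} (W : Subgroup (OrthGroup n)) : Prop :=
  Subgroup.closure {w | w ∈ W ∧ IsReflection w} = W

/-- `ℝⁿ` is an irreducible `W`-module: it is nonzero, and the only `W`-stable subspaces
are `0` and the whole space. -/
def IsIrreducibleGroup {n : ℕ} (W : Subgroup (OrthGroup n)) : Prop :=
  0 < n ∧ ∀ U : Submodule ℝ (Fin n → ℝ),
    (∀ w ∈ W, ∀ v ∈ U, Matrix.mulVec w.1 v ∈ U) → U = ⊥ ∨ U = ⊤

/-- The set of reflections in `W`, as a type. -/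
abbrev Refl {n : ℕ} (W : Subgroup (OrthGroup n)) := {s : W // IsReflection s.1}

/-- The conjugacy classes of reflections in `W`. A conjugation-invariant function on the
reflections is the same thing as a function on this type. -/
abbrev ReflClass {n : ℕ} (W : Subgroup (OrthGroup n)) :=
  {C : ConjClasses W // ∃ s : Refl W, ConjClasses.mk s.1 = C}

/-- The conjugacy class of a reflection. -/
def Refl.cls {n : ℕ} {W : Subgroup (OrthGroup n)} (s : Refl W) : ReflClass W :=
  ⟨ConjClasses.mk s.1, s, rfl⟩

/-- A root `α_s` of the reflection `s` (it is unique up to a nonzero real factor, and nothing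
below depends on this factor). -/
def Refl.root {n : ℕ} {W : Subgroup (OrthGroup n)} (s : Refl W) : Fin n → ℝ := s.2.choose

theorem Refl.hasRoot {n : ℕ} {W : Subgroup (OrthGroup n)} (s : Refl W) :
    HasRoot s.1.1 s.root := s.2.choose_spec

section Algebra

variable {n : ℕ} (R : Type) [CommRing R] [Algebra ℂ R]

/-- A real number, as an element of a complex algebra. -/
def realTo (r : ℝ) : R := algebraMap ℂ R (r : ℂ)

/-- The polynomial algebra `R[x₁, …, xₙ] = R ⊗ S(V)`, where `V = ℂⁿ` is the complexification
of `ℝⁿ` and `x₁, …, xₙ` is its standard basis. For `R = ℂ` it also serves as `S(V*)`, the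
variables being the dual basis; as the basis is orthonormal and `W` acts by orthogonal
matrices, the actions of `W` on `V` and on `V*` are given by the same matrices. -/
abbrev Poly (n : ℕ) (R : Type) [CommRing R] := MvPolynomial (Fin n) R

/-- The vector `v ∈ ℝⁿ`, as a linear element of `R ⊗ S(V)`. -/
def linForm (v : Fin n → ℝ) : Poly n R := ∑ i, C (realTo R (v i)) * X i

/-- The action of `w` on `R ⊗ S(V)` by algebra automorphisms: `w (x_j) = ∑ᵢ wᵢⱼ xᵢ`. -/
def act (w : OrthGroup n) : Poly n R →ₐ[R] Poly n R :=
  aeval fun j => linForm R fun i => w.1 i j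

/-- The algebra of `W`-invariants in `R ⊗ S(V)`. -/
def invariants (W : Subgroup (OrthGroup n)) : Subalgebra R (Poly n R) where
  carrier := {p | ∀ w ∈ W, act R w p = p}
  mul_mem' ha hb w hw := by rw [map_mul, ha w hw, hb w hw]
  add_mem' ha hb w hw := by rw [map_add, ha w hw, hb w hw]
  algebraMap_mem' r w _ := by rw [AlgHom.commutes]

variable {R}

theorem linForm_dvd_sub_act {w : OrthGroup n} {α : Fin n → ℝ} (h : HasRoot w α)
    (q : Poly n R) : linForm R α ∣ q - act R w q := by
  induction q using MvPolynomial.induction_on with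
  | C a =>
    have : act R w (C a) = C a := (act R w).commutes a
    rw [this, sub_self]
    exact dvd_zero _
  | add p q hp hq =>
    rw [map_add, add_sub_add_comm]
    exact dvd_add hp hq
  | mul_X p j hp =>
    have hX : act R w (X j) = X j - C (realTo R (2 / (α ⬝ᵥ α) * α j)) * linForm R α := by
      have h1 : ∀ i, w.1 i j = (if i = j then 1 else 0) - (2 / (α ⬝ᵥ α) * α j) * α i := by
        intro i
        rw [h.2]
        simp [Matrix.vecMulVec_apply, Matrix.one_apply]
        ring
      simp only [act, aeval_X, linForm, h1]
      rw [Finset.mul_sum, eq_sub_iff_add_eq, ← Finset.sum_add_distrib]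
      rw [Finset.sum_eq_single j]
      · simp only [realTo, if_true]
        push_cast
        simp only [map_sub, map_mul, map_one]
        ring
      · intro i _ hij
        simp only [realTo, if_neg hij]
        push_cast
        simp only [map_sub, map_mul, map_zero]
        ring
      · simp
    have : p * X j - act R w (p * X j)
        = (p - act R w p) * X j
          + act R w p * (C (realTo R (2 / (α ⬝ᵥ α) * α j)) * linForm R α) := by
      rw [map_mul, hX]
      ring
    rw [this]
    exact dvd_add (hp.mul_right _) (((dvd_refl _).mul_left _).mul_left _)

theorem linForm_ne_zero [IsDomain R] {α : Fin n → ℝ} (h : α ≠ 0) : linForm R α ≠ 0 := by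
  obtain ⟨j, hj⟩ := Function.ne_iff.mp h
  intro h0
  have h1 : coeff (Finsupp.single j 1) (linForm R α) = realTo R (α j) := by
    rw [linForm, coeff_sum, Finset.sum_eq_single j]
    · simp
    · intro i _ hij
      rw [coeff_C_mul, coeff_X, if_neg, mul_zero]
      intro he
      exact hij (Finsupp.single_left_injective one_ne_zero he)
    · simp
  rw [h0, coeff_zero] at h1
  have h2 : algebraMap ℂ R (α j : ℂ) = algebraMap ℂ R 0 := by rw [map_zero]; exact h1.symm
  have h3 := (algebraMap ℂ R).injective h2
  exact hj (by exact_mod_cast h3)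

variable {W : Subgroup (OrthGroup n)}

/-- The divided difference `(q - s q) / α_s`. -/
def divDiffFun (s : Refl W) (q : Poly n R) : Poly n R :=
  (linForm_dvd_sub_act (R := R) s.hasRoot q).choose

theorem linForm_mul_divDiffFun (s : Refl W) (q : Poly n R) :
    linForm R s.root * divDiffFun s q = q - act R s.1.1 q :=
  (linForm_dvd_sub_act (R := R) s.hasRoot q).choose_spec.symm

variable [IsDomain R]

/-- The divided difference `q ↦ (q - s q) / α_s`, as a linear operator. -/
def divDiff (s : Refl W) : Module.End R (Poly n R) where
  toFun := divDiffFun s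
  map_add' p q := by
    apply mul_left_cancel₀ (linForm_ne_zero (R := R) s.hasRoot.1)
    rw [mul_add]
    simp only [linForm_mul_divDiffFun, map_add]
    ring
  map_smul' r q := by
    apply mul_left_cancel₀ (linForm_ne_zero (R := R) s.hasRoot.1)
    rw [RingHom.id_apply, mul_smul_comm]
    simp only [linForm_mul_divDiffFun, map_smul, smul_sub]

/-- The Dunkl operator
`∇_y q = ∂q/∂y - ∑ₛ c(s) ⟨y, α_s⟩ (q - s q) / α_s` for `y` the `j`-th vector of the dual basis;
`c` is a function on the conjugacy classes of reflections with values in `R`. -/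
def dunkl (c : ReflClass W → R) (j : Fin n) : Module.End R (Poly n R) :=
  (pderiv j).toLinearMap - ∑ᶠ s : Refl W, (c s.cls * realTo R (s.root j)) • divDiff s

/-- The operator `∇_p` for `p ∈ S(V*)`: it is linear in `p`, and for a monomial `p` it is the
corresponding product of the Dunkl operators of the basis vectors (these commute, so that the
order of the factors does not matter; they are written in increasing order). -/
def dunklPoly (c : ReflClass W → R) (p : Poly n ℂ) : Module.End R (Poly n R) :=
  ∑ a ∈ p.support,
    algebraMap ℂ R (coeff a p) • (List.ofFn fun i : Fin n => dunkl c i ^ a i).prod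

/-- The elements of `R ⊗ S(V)` which are annihilated by `∇_p` for all homogeneous
`W`-invariant `p ∈ S(V*)` of degree `k` with `0 < k < d`. -/
def quasiharmonic (c : ReflClass W → R) (d : ℕ) : Submodule R (Poly n R) where
  carrier := {x | ∀ k, 0 < k → k < d → ∀ p ∈ invariants ℂ W,
    p.IsHomogeneous k → dunklPoly c p x = 0}
  zero_mem' _ _ _ _ _ _ := map_zero _
  add_mem' ha hb k h0 hd p hp hk := by
    rw [map_add, ha k h0 hd p hp hk, hb k h0 hd p hp hk, add_zero]
  smul_mem' r x hx k h0 hd p hp hk := by rw [map_smul, hx k h0 hd p hp hk, smul_zero]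

end Algebra

variable {n : ℕ} (W : Subgroup (OrthGroup n))

/-- The elements `f₁, …, fₙ` are a system of basic (elementary) invariants of `W`: they are
algebraically independent, and `S(V)^W = ℂ[f₁, …, fₙ]`. -/
def IsBasicSystem (f : Fin n → Poly n ℂ) : Prop :=
  AlgebraicIndependent ℂ f ∧ Algebra.adjoin ℂ (Set.range f) = invariants ℂ W

/-- The numbers `d₁ ≤ … ≤ dₙ` are the degrees of `W`, that is, the degrees of some system of
homogeneous basic invariants. -/
def IsDegreeSequence (d : Fin n → ℕ) : Prop :=
  Monotone d ∧ ∃ f : Fin n → Poly n ℂ, (∀ i, (f i).IsHomogeneous (d i)) ∧ IsBasicSystem W f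

/-- The ring `ℂ[c]` of polynomials in one parameter for each conjugacy class of reflections. -/
abbrev ParamRing := MvPolynomial (ReflClass W) ℂ

/-- The universal conjugation-invariant function on reflections, with values in `ℂ[c]`. -/
def univParam : ReflClass W → ParamRing W := fun C => X C

/-- The elements `e₁, …, eₙ` of `ℂ[c] ⊗ S(V)` are deformed canonical invariants of degrees
`d₁, …, dₙ`: the element `eᵢ` is `W`-invariant, homogeneous of degree `dᵢ` with respect to
`S(V)`, and annihilated by the universal operators `∇_p` for all `W`-invariant `p` of positive
degree less than `dᵢ`; and `e₁, …, eₙ` are linearly independent over `ℂ[c]`.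
If the `dᵢ` are distinct, then the last condition says just that every `eᵢ` is nonzero.
If some of them coincide, then it says that the `eᵢ` of the same degree are linearly
independent (which is the case for two nonzero elements, one of them invariant and the other
one skew-invariant under an involution). -/
def IsCanonicalSystem (d : Fin n → ℕ) (e : Fin n → Poly n (ParamRing W)) : Prop :=
  (∀ i, e i ∈ invariants (ParamRing W) W ∧ (e i).IsHomogeneous (d i) ∧
    e i ∈ quasiharmonic (univParam W) (d i)) ∧
  LinearIndependent (ParamRing W) e

/-- The specialization `ℂ[c] ⊗ S(V) → S(V)` at a value of the parameters. -/
def specialize (c : ReflClass W → ℂ) : Poly n (ParamRing W) →+* Poly n ℂ :=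
  MvPolynomial.map (MvPolynomial.eval c)

end DeformedInvariants

end

/-! Put ⟨p, q⟩ = (∇_p q)(0). As Dunkl operators commute, ⟨p p', q⟩ = ⟨p, ∇_{p'} q⟩. At c = 0 this is
the pairing by ordinary differentiation, with ⟨p̄, p⟩ > 0 for p ≠ 0. Hence on a finite-dimensional
space of complex polynomials stable under complex conjugation the Gram determinant is a nonzero
polynomial in c, and the pairing is nondegenerate over ℂ[c].

Let I_m be the invariants of degree m > 0 and D_m ⊂ I_m the span of products of two invariants of
positive degree. For basic invariants f_j, I_m is the direct sum of D_m and the span of the f_j with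
d_j = m; the linear forms l_j read off the coefficients of the f_j and vanish on D_m. By adjointness
and nondegeneracy on lower degrees, an invariant of degree m satisfies the canonical equations
exactly when it is orthogonal to D_m (`pairing_eq_zero_of_quasiharmonic`,
`quasiharmonic_of_pairing_eq_zero`).

Existence: project f_i to the orthogonal complement of D_m, clearing the denominator by the Gram
determinant. Genericity: F = det(l_j(e_i)). If F were zero, some nontrivial combination of the e_i
of one degree would have no linear part, so it would lie in ℂ[c] ⊗ D_m and be orthogonal to D_m,
hence be zero, against linear independence (`det_extendForm_ne_zero`). Where F(c) ≠ 0, the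
specialized elements generate all invariants by induction on the degree, and a surjective
endomorphism of a Noetherian ring being injective, they are algebraically independent
(`isBasicSystem_of_det_ne_zero`).

The existence of the f_j is Chevalley's theorem, proved by his argument with a relation of minimal
degree. -/

noncomputable section

namespace DeformedInvariants

/-! ### Graded pieces of polynomials -/

section Graded

variable {σ R : Type*} [CommRing R]

theorem homogeneousComponent_mul_of_isHomogeneous {g : MvPolynomial σ R} {e : ℕ}
    (hg : g.IsHomogeneous e) (p : MvPolynomial σ R) (m : ℕ) :
    homogeneousComponent (m + e) (p * g) = homogeneousComponent m p * g := by
  conv_lhs => rw [← sum_homogeneousComponent p, Finset.sum_mul, map_sum]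
  have h : ∀ i, homogeneousComponent (m + e) (homogeneousComponent i p * g)
      = if m = i then homogeneousComponent i p * g else 0 := by
    intro i
    rw [homogeneousComponent_of_mem (n := i + e)
      ((homogeneousComponent_isHomogeneous i p).mul hg)]
    simp
  simp only [h]
  rw [Finset.sum_ite_eq]
  split_ifs with hm
  · rfl
  · rw [homogeneousComponent_eq_zero, zero_mul]
    simpa using hm

theorem homogeneousComponent_mul_of_lt {g : MvPolynomial σ R} {e : ℕ}
    (hg : g.IsHomogeneous e) (p : MvPolynomial σ R) {m : ℕ} (h : m < e) :
    homogeneousComponent m (p * g) = 0 := by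
  conv_lhs => rw [← sum_homogeneousComponent p, Finset.sum_mul, map_sum]
  refine Finset.sum_eq_zero fun i _ => ?_
  rw [homogeneousComponent_of_mem (n := i + e)
      ((homogeneousComponent_isHomogeneous i p).mul hg), if_neg (by omega)]

theorem homogeneousComponent_apply_of_graded {τ S F : Type*} [CommRing S]
    [FunLike F (MvPolynomial σ R) (MvPolynomial τ S)]
    [AddMonoidHomClass F (MvPolynomial σ R) (MvPolynomial τ S)] (φ : F)
    (hφ : ∀ p m, IsHomogeneous p m → (φ p).IsHomogeneous m) (p : MvPolynomial σ R) (m : ℕ) :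
    homogeneousComponent m (φ p) = φ (homogeneousComponent m p) := by
  conv_lhs => rw [← sum_homogeneousComponent p, map_sum, map_sum]
  have h : ∀ i, homogeneousComponent m (φ (homogeneousComponent i p))
      = if m = i then φ (homogeneousComponent i p) else 0 := fun i =>
    homogeneousComponent_of_mem (hφ _ _ (homogeneousComponent_isHomogeneous i p))
  simp only [h]
  rw [Finset.sum_ite_eq]
  split_ifs with hm
  · rfl
  · rw [homogeneousComponent_eq_zero, map_zero]
    simpa using hm

theorem constantCoeff_eq_zero_of_isHomogeneous {p : MvPolynomial σ R} {m : ℕ}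
    (hp : p.IsHomogeneous m) (hm : m ≠ 0) : constantCoeff p = 0 := by
  rw [constantCoeff_eq]
  exact hp.coeff_eq_zero (by simpa using hm.symm)

theorem isHomogeneous_zero_eq_C {p : MvPolynomial σ R} (hp : p.IsHomogeneous 0) :
    p = C (constantCoeff p) := by
  rw [constantCoeff_eq, ← homogeneousComponent_zero, homogeneousComponent_eq_self hp]

end Graded

/-! ### The action of the orthogonal group -/

section Action

variable {n : ℕ} {R : Type} [CommRing R] [Algebra ℂ R]

theorem realTo_add (a b : ℝ) : realTo R (a + b) = realTo R a + realTo R b := by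
  simp [realTo]

theorem realTo_sub (a b : ℝ) : realTo R (a - b) = realTo R a - realTo R b := by
  simp [realTo]

theorem realTo_mul (a b : ℝ) : realTo R (a * b) = realTo R a * realTo R b := by
  simp [realTo]

theorem realTo_zero : realTo R 0 = 0 := by simp [realTo]

theorem realTo_one : realTo R 1 = 1 := by simp [realTo]

theorem realTo_sum {ι : Type*} (s : Finset ι) (f : ι → ℝ) :
    realTo R (∑ i ∈ s, f i) = ∑ i ∈ s, realTo R (f i) := by simp [realTo]

theorem act_X (w : OrthGroup n) (j : Fin n) :
    act R w (X j) = ∑ i, C (realTo R (w.1 i j)) * X i := by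
  simp [act, linForm]

theorem act_C (w : OrthGroup n) (a : R) : act R w (C a) = C a := (act R w).commutes a

theorem act_mul (v w : OrthGroup n) (p : Poly n R) : act R (v * w) p = act R v (act R w p) := by
  suffices h : act R (v * w) = (act R v).comp (act R w) by rw [h, AlgHom.comp_apply]
  ext1 j
  simp only [AlgHom.comp_apply, act_X, map_sum, map_mul, act_C, Finset.mul_sum]
  rw [Finset.sum_comm]
  refine Finset.sum_congr rfl fun i _ => ?_
  simp only [← mul_assoc, ← map_mul, ← realTo_mul]
  rw [← Finset.sum_mul, ← map_sum, ← realTo_sum]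
  congr 3
  simp [Matrix.mul_apply, mul_comm]

theorem act_one (p : Poly n R) : act R (1 : OrthGroup n) p = p := by
  suffices h : act R (1 : OrthGroup n) = AlgHom.id R _ by rw [h, AlgHom.id_apply]
  ext1 j
  simp [act_X, Matrix.one_apply, realTo, apply_ite]

theorem isHomogeneous_act (w : OrthGroup n) {p : Poly n R} {m : ℕ} (hp : p.IsHomogeneous m) :
    (act R w p).IsHomogeneous m := by
  have := hp.aeval (S := R) (fun j => linForm R fun i => w.1 i j) (n := 1)
    (fun j => IsHomogeneous.sum _ _ _ fun i _ => isHomogeneous_C_mul_X _ _)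
  rwa [one_mul] at this

theorem homogeneousComponent_act (w : OrthGroup n) (p : Poly n R) (m : ℕ) :
    homogeneousComponent m (act R w p) = act R w (homogeneousComponent m p) :=
  homogeneousComponent_apply_of_graded (act R w) (fun _ _ => isHomogeneous_act w) p m

theorem totalDegree_act_le (w : OrthGroup n) (p : Poly n R) :
    (act R w p).totalDegree ≤ p.totalDegree := by
  conv_lhs => rw [← sum_homogeneousComponent p, map_sum]
  refine totalDegree_finsetSum_le fun i hi => ?_
  exact (isHomogeneous_act w (homogeneousComponent_isHomogeneous i p)).totalDegree_le.trans
    (by simpa using Finset.mem_range_succ_iff.mp hi)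

theorem map_act {R' : Type} [CommRing R'] [Algebra ℂ R'] (φ : R →+* R')
    (hφ : ∀ r, φ (realTo R r) = realTo R' r) (w : OrthGroup n) (p : Poly n R) :
    map φ (act R w p) = act R' w (map φ p) := by
  induction p using MvPolynomial.induction_on with
  | C a => simp
  | add p q hp hq => simp [hp, hq]
  | mul_X p j hp => simp [hp, act_X, hφ]

variable {W : Subgroup (OrthGroup n)}

theorem mem_invariants {p : Poly n R} :
    p ∈ invariants R W ↔ ∀ w ∈ W, act R w p = p := Iff.rfl

theorem homogeneousComponent_mem_invariants {p : Poly n R} (hp : p ∈ invariants R W) (m : ℕ) :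
    homogeneousComponent m p ∈ invariants R W := fun w hw => by
  rw [← homogeneousComponent_act, hp w hw]

theorem map_mem_invariants {R' : Type} [CommRing R'] [Algebra ℂ R'] (φ : R →+* R')
    (hφ : ∀ r, φ (realTo R r) = realTo R' r) {p : Poly n R} (hp : p ∈ invariants R W) :
    map φ p ∈ invariants R' W := fun w hw => by rw [← map_act φ hφ, hp w hw]

variable (R W) in
/-- The projection of the polynomial algebra onto the invariants by averaging. -/
def reynolds [Fintype W] : Poly n R →ₗ[R] Poly n R where
  toFun p := algebraMap ℂ R (Fintype.card W : ℂ)⁻¹ • ∑ w : W, act R w.1 p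
  map_add' p q := by simp only [map_add, Finset.sum_add_distrib, smul_add]
  map_smul' r p := by simp only [map_smul, ← Finset.smul_sum, RingHom.id_apply, smul_comm r]

theorem reynolds_apply [Fintype W] (p : Poly n R) :
    reynolds R W p = algebraMap ℂ R (Fintype.card W : ℂ)⁻¹ • ∑ w : W, act R w.1 p := rfl

theorem sum_act_mul_left [Fintype W] (w : W) (p : Poly n R) :
    ∑ v : W, act R (w.1 * v.1) p = ∑ v : W, act R v.1 p := by
  have := Equiv.sum_comp (Equiv.mulLeft w) fun v : W => act R v.1 p
  simpa only [Equiv.coe_mulLeft, Subgroup.coe_mul] using this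

theorem reynolds_mem [Fintype W] (p : Poly n R) : reynolds R W p ∈ invariants R W := by
  rw [mem_invariants]
  intro w hw
  rw [reynolds_apply, map_smul, map_sum]
  simp only [← act_mul]
  rw [sum_act_mul_left ⟨w, hw⟩ p]

theorem algebraMap_card_inv_mul (G : Type*) [Fintype G] [Nonempty G] :
    algebraMap ℂ R (Fintype.card G : ℂ)⁻¹ * (Fintype.card G : R) = 1 := by
  have h : (Fintype.card G : R) = algebraMap ℂ R (Fintype.card G : ℂ) := by simp
  rw [h, ← map_mul, inv_mul_cancel₀ (by exact_mod_cast Fintype.card_ne_zero), map_one]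

theorem reynolds_mul [Fintype W] {p : Poly n R} (hp : p ∈ invariants R W) (q : Poly n R) :
    reynolds R W (p * q) = p * reynolds R W q := by
  rw [reynolds_apply, reynolds_apply, mul_smul_comm, Finset.mul_sum]
  congr 1
  exact Finset.sum_congr rfl fun w _ => by rw [map_mul, hp w.1 w.2]

theorem reynolds_of_mem [Fintype W] {p : Poly n R} (hp : p ∈ invariants R W) :
    reynolds R W p = p := by
  rw [reynolds_apply, Finset.sum_congr rfl fun w _ => hp w.1 w.2, Finset.sum_const,
    Finset.card_univ, ← Nat.cast_smul_eq_nsmul R, smul_smul, algebraMap_card_inv_mul, one_smul]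

theorem isHomogeneous_smul {σ R : Type*} [CommRing R] {p : MvPolynomial σ R} {m : ℕ} (r : R) (hp : p.IsHomogeneous m) :
    (r • p).IsHomogeneous m := (homogeneousSubmodule σ R m).smul_mem r hp

theorem isHomogeneous_reynolds [Fintype W] {p : Poly n R} {m : ℕ} (hp : p.IsHomogeneous m) :
    (reynolds R W p).IsHomogeneous m := by
  rw [reynolds_apply]
  exact isHomogeneous_smul _ (IsHomogeneous.sum _ _ _ fun w _ => isHomogeneous_act w.1 hp)

end Action

/-! ### Dunkl operators: commutation relations, equivariance, commutativity -/

section DunklRelations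

variable {n : ℕ} {R : Type} [CommRing R] [Algebra ℂ R] {W : Subgroup (OrthGroup n)}

theorem linForm_isHomogeneous (v : Fin n → ℝ) : (linForm R v).IsHomogeneous 1 :=
  IsHomogeneous.sum _ _ _ fun _ _ => isHomogeneous_C_mul_X _ _

theorem linForm_single (k : Fin n) : linForm R (Pi.single k 1) = X k := by
  rw [linForm, Finset.sum_eq_single k]
  · simp [realTo_one]
  · intro i _ hi
    simp [hi, realTo_zero]
  · simp

theorem act_linForm (w : OrthGroup n) (v : Fin n → ℝ) :
    act R w (linForm R v) = linForm R (w.1.mulVec v) := by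
  simp only [linForm, map_sum, map_mul, act_C, act_X, Finset.mul_sum, Matrix.mulVec, dotProduct,
    realTo_sum, Finset.sum_mul]
  rw [Finset.sum_comm]
  refine Finset.sum_congr rfl fun i _ => Finset.sum_congr rfl fun j _ => ?_
  rw [realTo_mul, map_mul]
  ring

theorem one_sub_apply_of_hasRoot {w : OrthGroup n} {α : Fin n → ℝ} (h : HasRoot w α)
    (i j : Fin n) : (1 - w.1) i j = 2 / (α ⬝ᵥ α) * (α i * α j) := by
  rw [h.2, sub_sub_cancel]
  simp [Matrix.vecMulVec_apply]

theorem one_sub_mulVec_of_hasRoot {w : OrthGroup n} {α : Fin n → ℝ} (h : HasRoot w α)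
    (v : Fin n → ℝ) : (1 - w.1).mulVec v = (2 / (α ⬝ᵥ α) * (α ⬝ᵥ v)) • α := by
  ext i
  simp only [Matrix.mulVec, dotProduct, one_sub_apply_of_hasRoot h, Pi.smul_apply, smul_eq_mul,
    Finset.mul_sum, Finset.sum_mul]
  exact Finset.sum_congr rfl fun j _ => by ring

theorem linForm_smul (r : ℝ) (v : Fin n → ℝ) :
    linForm R (r • v) = C (realTo R r) * linForm R v := by
  simp only [linForm, Finset.mul_sum, Pi.smul_apply, smul_eq_mul, realTo_mul, map_mul, mul_assoc]

theorem linForm_sub (v v' : Fin n → ℝ) : linForm R (v - v') = linForm R v - linForm R v' := by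
  simp only [linForm, Pi.sub_apply, realTo_sub, map_sub, sub_mul, Finset.sum_sub_distrib]

theorem isReflection_conj {w : OrthGroup n} (h : IsReflection w) (v : OrthGroup n) :
    IsReflection (v * w * v⁻¹) := by
  obtain ⟨α, hα, hw⟩ := h
  have hv : v.1.transpose * v.1 = 1 := Matrix.UnitaryGroup.star_mul_self v
  have hv' : v.1 * v.1.transpose = 1 := mul_eq_one_comm.mp hv
  have hinv : (v⁻¹).1 = v.1.transpose := rfl
  refine ⟨v.1.mulVec α, fun h0 => hα ?_, ?_⟩
  · have := congrArg (v.1.transpose.mulVec) h0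
    rwa [Matrix.mulVec_mulVec, hv, Matrix.one_mulVec, Matrix.mulVec_zero] at this
  · have hdot : v.1.mulVec α ⬝ᵥ v.1.mulVec α = α ⬝ᵥ α := by
      rw [Matrix.dotProduct_mulVec, Matrix.vecMul_mulVec, ← Matrix.dotProduct_mulVec]
      rw [hv, Matrix.one_mulVec]
    rw [hdot]
    change v.1 * w.1 * (v⁻¹).1 = _
    rw [hinv, hw, mul_sub, sub_mul, mul_one, hv', mul_smul_comm, smul_mul_assoc,
      Matrix.mul_vecMulVec, Matrix.vecMulVec_mul, Matrix.vecMul_transpose]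

/-- Conjugation by an element of the group, as a permutation of its reflections. -/
def Refl.conj (w : W) : Refl W ≃ Refl W :=
  (MulAut.conj w).toEquiv.subtypeEquiv fun s =>
    ⟨fun h => isReflection_conj h w.1, fun h => by
      have := isReflection_conj h w.1⁻¹
      simpa [mul_assoc] using this⟩

theorem Refl.coe_conj (w : W) (s : Refl W) :
    (Refl.conj w s).1.1 = w.1 * s.1.1 * w.1⁻¹ := rfl

theorem Refl.cls_conj (w : W) (s : Refl W) : (Refl.conj w s).cls = s.cls := by
  refine Subtype.ext (ConjClasses.mk_eq_mk_iff_isConj.mpr (IsConj.symm ?_))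
  exact isConj_iff.mpr ⟨w, rfl⟩

theorem pderiv_linForm (v : Fin n → ℝ) (j : Fin n) :
    pderiv j (linForm R v) = C (realTo R (v j)) := by
  rw [linForm, map_sum, Finset.sum_eq_single j]
  · simp
  · intro i _ hi
    simp [pderiv_X_of_ne hi]
  · simp

theorem act_smul (w : OrthGroup n) (r : R) (q : Poly n R) :
    act R w (r • q) = r • act R w q := map_smul _ _ _

variable [IsDomain R]

theorem linForm_mul_divDiff (s : Refl W) (q : Poly n R) :
    linForm R s.root * divDiff s q = q - act R s.1.1 q := linForm_mul_divDiffFun s q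

/-- Twisted Leibniz rule: v q - s(v) s(q) = v (q - s q) + (v - s v) s(q), and v - s v is a multiple
of the root. With the factor α_j, the coefficient of s(q) becomes a component of (1 - s) v, in which
the choice of root no longer appears. -/
theorem divDiff_linForm_mul (s : Refl W) (v : Fin n → ℝ) (q : Poly n R) (j : Fin n) :
    realTo R (s.root j) • divDiff s (linForm R v * q)
      = linForm R v * realTo R (s.root j) • divDiff s q
        + realTo R ((1 - s.1.1.1).mulVec v j) • act R s.1.1 q := by
  apply mul_left_cancel₀ (linForm_ne_zero (R := R) s.hasRoot.1)
  have h1 : linForm R v - act R s.1.1 (linForm R v)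
      = C (realTo R (2 / (s.root ⬝ᵥ s.root) * (s.root ⬝ᵥ v))) * linForm R s.root := by
    rw [act_linForm, ← linForm_sub, ← linForm_smul, ← one_sub_mulVec_of_hasRoot s.hasRoot,
      Matrix.sub_mulVec, Matrix.one_mulVec]
  have h2 : act R s.1.1 (linForm R v) = linForm R v -
      C (realTo R (2 / (s.root ⬝ᵥ s.root) * (s.root ⬝ᵥ v))) * linForm R s.root := by
    rw [← h1, sub_sub_cancel]
  have h3 := linForm_mul_divDiff (R := R) s q
  rw [one_sub_mulVec_of_hasRoot s.hasRoot, Pi.smul_apply, smul_eq_mul, realTo_mul]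
  simp only [smul_eq_C_mul, map_mul]
  rw [mul_left_comm, linForm_mul_divDiff, map_mul, h2]
  linear_combination (-C (realTo R (s.root j)) * linForm R v) * h3

variable [Fintype (Refl W)]

theorem dunkl_apply (c : ReflClass W → R) (j : Fin n) (q : Poly n R) :
    dunkl c j q = pderiv j q - ∑ s : Refl W, c s.cls • realTo R (s.root j) • divDiff s q := by
  rw [dunkl, finsum_eq_sum_of_fintype, LinearMap.sub_apply, LinearMap.sum_apply]
  simp only [LinearMap.smul_apply, mul_smul]
  rfl

/-- The commutator relation of the rational Cherednik algebra. Equivariance, commutativity and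
homogeneity of Dunkl operators follow from it, together with their vanishing on constants, by
induction. -/
theorem dunkl_linForm_mul (c : ReflClass W → R) (j : Fin n) (v : Fin n → ℝ) (q : Poly n R) :
    dunkl c j (linForm R v * q) = linForm R v * dunkl c j q + realTo R (v j) • q
      - ∑ s : Refl W, c s.cls • realTo R ((1 - s.1.1.1).mulVec v j) • act R s.1.1 q := by
  have h : ∀ s : Refl W, c s.cls • realTo R (s.root j) • divDiff s (linForm R v * q)
      = linForm R v * (c s.cls • realTo R (s.root j) • divDiff s q)
        + c s.cls • realTo R ((1 - s.1.1.1).mulVec v j) • act R s.1.1 q := fun s => by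
    rw [divDiff_linForm_mul, smul_add]
    simp only [mul_smul_comm]
  simp only [dunkl_apply, h, Derivation.leibniz, pderiv_linForm, Finset.sum_add_distrib,
    ← Finset.mul_sum]
  simp only [smul_eq_mul, smul_eq_C_mul]
  ring

theorem dunkl_X_mul (c : ReflClass W → R) (j k : Fin n) (q : Poly n R) :
    dunkl c j (X k * q) = X k * dunkl c j q + realTo R ((1 : Matrix (Fin n) (Fin n) ℝ) j k) • q
      - ∑ s : Refl W, c s.cls • realTo R ((1 - s.1.1.1) j k) • act R s.1.1 q := by
  have := dunkl_linForm_mul c j (Pi.single k 1) q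
  have h1 : (Pi.single k 1 : Fin n → ℝ) j = (1 : Matrix (Fin n) (Fin n) ℝ) j k := by
    rw [Pi.single_apply, Matrix.one_apply]
  simpa only [linForm_single, Matrix.mulVec_single_one, Matrix.col_apply, h1] using this

theorem dunkl_C (c : ReflClass W → R) (j : Fin n) (a : R) : dunkl c j (C a) = 0 := by
  rw [dunkl_apply, pderiv_C, zero_sub, neg_eq_zero]
  refine Finset.sum_eq_zero fun s _ => ?_
  have : divDiff s (C a : Poly n R) = 0 := by
    apply mul_left_cancel₀ (linForm_ne_zero (R := R) s.hasRoot.1)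
    rw [linForm_mul_divDiff, act_C, sub_self, mul_zero]
  rw [this, smul_zero, smul_zero]

/-- Dunkl operators are equivariant. -/
theorem act_dunkl (c : ReflClass W → R) (w : W) (j : Fin n) (q : Poly n R) :
    act R w.1 (dunkl c j q) = ∑ i, realTo R (w.1.1 i j) • dunkl c i (act R w.1 q) := by
  have hw : w.1.1.transpose * w.1.1 = 1 := Matrix.UnitaryGroup.star_mul_self w.1
  induction q using MvPolynomial.induction_on with
  | C a => simp [dunkl_C]
  | add p q hp hq => simp only [map_add, hp, hq, smul_add, Finset.sum_add_distrib]
  | mul_X q k hq =>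
    have hX : act R w.1 (X k) = linForm R fun i => w.1.1 i k := by
      rw [act_X, linForm]
    rw [mul_comm q, dunkl_X_mul, map_mul, map_sub, map_add, map_mul, hq, act_smul, map_sum, hX]
    simp only [dunkl_linForm_mul, smul_sub, smul_add, Finset.sum_sub_distrib,
      Finset.sum_add_distrib]
    congr 1
    · congr 1
      · rw [Finset.mul_sum]
        exact Finset.sum_congr rfl fun i _ => mul_smul_comm _ _ _
      · simp only [smul_smul, ← realTo_mul]
        rw [← Finset.sum_smul, ← realTo_sum, ← hw]
        rfl
    · simp only [Finset.smul_sum]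
      rw [Finset.sum_comm]
      -- The reflection terms match under s ↦ w s w⁻¹: the parameter is constant on conjugacy
      -- classes, and wᵀ(1 - w s w⁻¹)w = 1 - s compares the coefficients.
      refine Fintype.sum_equiv (Refl.conj w) _ _ fun s => ?_
      rw [act_smul, act_smul, Refl.cls_conj]
      simp only [Refl.coe_conj, ← act_mul, inv_mul_cancel_right]
      simp only [smul_comm _ (c s.cls)]
      rw [← Finset.smul_sum]
      congr 1
      simp only [smul_smul, ← realTo_mul]
      rw [← Finset.sum_smul, ← realTo_sum]
      congr 2
      have h1 : w.1.1.transpose * (1 - (w.1 * s.1.1 * w.1⁻¹).1) * w.1.1 = 1 - s.1.1.1 := by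
        have h2 : (w.1 * s.1.1 * w.1⁻¹).1 = w.1.1 * s.1.1.1 * w.1.1.transpose := rfl
        rw [h2, mul_sub, sub_mul, mul_one, hw]
        rw [Matrix.mul_assoc w.1.1, ← Matrix.mul_assoc w.1.1.transpose, hw, Matrix.one_mul,
          Matrix.mul_assoc, hw, Matrix.mul_one]
      rw [← h1, Matrix.mul_assoc, Matrix.mul_apply]
      rfl

theorem dunkl_act_sub_act_dunkl (c : ReflClass W → R) (s : Refl W) (j : Fin n) (q : Poly n R) :
    dunkl c j (act R s.1.1 q) - act R s.1.1 (dunkl c j q)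
      = ∑ i, realTo R ((1 - s.1.1.1) i j) • dunkl c i (act R s.1.1 q) := by
  rw [act_dunkl, sub_eq_iff_eq_add, ← Finset.sum_add_distrib]
  simp only [← add_smul, ← realTo_add]
  have : ∀ i, (1 - s.1.1.1) i j + s.1.1.1 i j = (1 : Matrix (Fin n) (Fin n) ℝ) i j := by simp
  simp only [this]
  rw [Finset.sum_eq_single j]
  · simp [realTo_one]
  · intro i _ hi
    simp [Matrix.one_apply_ne hi, realTo_zero]
  · simp

/-- The matrix 1 - s has rank one, with entries proportional to α_i α_j, so (1 - s)_{ak} (1 -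
s)_{ib} is symmetric in a and b. This cancels the reflection terms in the commutator of two Dunkl
operators. -/
theorem smul_dunkl_act_sub_symm (c : ReflClass W → R) (s : Refl W) (a b k : Fin n)
    (q : Poly n R) :
    realTo R ((1 - s.1.1.1) a k) • (dunkl c b (act R s.1.1 q) - act R s.1.1 (dunkl c b q))
      = realTo R ((1 - s.1.1.1) b k) •
        (dunkl c a (act R s.1.1 q) - act R s.1.1 (dunkl c a q)) := by
  rw [dunkl_act_sub_act_dunkl, dunkl_act_sub_act_dunkl, Finset.smul_sum, Finset.smul_sum]
  refine Finset.sum_congr rfl fun i _ => ?_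
  rw [smul_smul, smul_smul, ← realTo_mul, ← realTo_mul]
  congr 2
  simp only [one_sub_apply_of_hasRoot s.hasRoot]
  ring

/-- Dunkl operators commute. -/
theorem dunkl_comm (c : ReflClass W → R) (a b : Fin n) (q : Poly n R) :
    dunkl c a (dunkl c b q) = dunkl c b (dunkl c a q) := by
  induction q using MvPolynomial.induction_on with
  | C a => simp [dunkl_C]
  | add p q hp hq => simp only [map_add, hp, hq]
  | mul_X q k hq =>
    have key : ∑ s : Refl W, c s.cls • realTo R ((1 - s.1.1.1) a k) •
          (dunkl c b (act R s.1.1 q) - act R s.1.1 (dunkl c b q))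
        = ∑ s : Refl W, c s.cls • realTo R ((1 - s.1.1.1) b k) •
          (dunkl c a (act R s.1.1 q) - act R s.1.1 (dunkl c a q)) :=
      Finset.sum_congr rfl fun s _ => by rw [smul_dunkl_act_sub_symm]
    simp only [smul_sub, Finset.sum_sub_distrib] at key
    rw [sub_eq_sub_iff_add_eq_add] at key
    rw [mul_comm q, dunkl_X_mul, dunkl_X_mul, map_sub, map_sub, map_add, map_add, dunkl_X_mul,
      dunkl_X_mul, hq, map_sum, map_sum]
    simp only [map_smul]
    rw [sub_eq_sub_iff_add_eq_add]
    generalize (∑ s : Refl W, c s.cls • realTo R ((1 - s.1.1.1) a k) •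
      (dunkl c b (act R s.1.1 q))) = A at key ⊢
    generalize (∑ s : Refl W, c s.cls • realTo R ((1 - s.1.1.1) b k) •
      (dunkl c a (act R s.1.1 q))) = B at key ⊢
    generalize (∑ s : Refl W, c s.cls • realTo R ((1 - s.1.1.1) a k) •
      (act R s.1.1 (dunkl c b q))) = A' at key ⊢
    generalize (∑ s : Refl W, c s.cls • realTo R ((1 - s.1.1.1) b k) •
      (act R s.1.1 (dunkl c a q))) = B' at key ⊢
    linear_combination key

end DunklRelations

/-! ### The operators ∇_p: multiplicativity, equivariance, homogeneity -/

section DunklPoly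

variable {n : ℕ} {R : Type} [CommRing R] [Algebra ℂ R] {W : Subgroup (OrthGroup n)}
  [IsDomain R] [Fintype (Refl W)]

/-- There is an algebra homomorphism which sends the variables to the Dunkl operators, and
`∇_p` is its value at `p`. -/
theorem exists_dunklPoly_algHom (c : ReflClass W → R) :
    ∃ φ : Poly n R →ₐ[R] Module.End R (Poly n R),
      (∀ j, φ (X j) = dunkl c j) ∧ ∀ p, dunklPoly c p = φ (map (algebraMap ℂ R) p) := by
  -- Evaluation of polynomials needs a commutative target; the subalgebra generated by the commuting
  -- Dunkl operators provides it.
  let A := Algebra.adjoin R (Set.range (dunkl c))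
  have hA : IsMulCommutative A := by
    refine Algebra.isMulCommutative_adjoin R ?_
    rintro _ ⟨a, rfl⟩ _ ⟨b, rfl⟩
    exact LinearMap.ext fun q => dunkl_comm c a b q
  let _ : CommRing A := { (inferInstance : Ring A) with mul_comm := hA.is_comm.comm }
  let T : Fin n → A := fun j => ⟨dunkl c j, Algebra.subset_adjoin ⟨j, rfl⟩⟩
  refine ⟨A.val.comp (aeval T), fun j => by simp [T], fun p => ?_⟩
  have h : ∀ a : Fin n →₀ ℕ, A.val (∏ i, T i ^ a i)
      = (List.ofFn fun i : Fin n => dunkl c i ^ a i).prod := fun a => by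
    rw [← List.prod_ofFn, map_list_prod, List.map_ofFn]
    congr 2
  conv_rhs => rw [p.as_sum]
  rw [map_sum, map_sum, dunklPoly]
  refine Finset.sum_congr rfl fun a _ => ?_
  rw [map_monomial, AlgHom.comp_apply, aeval_monomial, ← h, ← Algebra.smul_def, map_smul,
    Finsupp.prod_fintype _ _ (by simp)]

theorem dunklPoly_add (c : ReflClass W → R) (p q : Poly n ℂ) :
    dunklPoly c (p + q) = dunklPoly c p + dunklPoly c q := by
  obtain ⟨φ, -, h⟩ := exists_dunklPoly_algHom c
  simp only [h, map_add]

theorem dunklPoly_mul (c : ReflClass W → R) (p q : Poly n ℂ) :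
    dunklPoly c (p * q) = dunklPoly c p * dunklPoly c q := by
  obtain ⟨φ, -, h⟩ := exists_dunklPoly_algHom c
  simp only [h, map_mul]

theorem dunklPoly_C (c : ReflClass W → R) (a : ℂ) :
    dunklPoly c (C a) = algebraMap ℂ R a • 1 := by
  obtain ⟨φ, -, h⟩ := exists_dunklPoly_algHom c
  rw [h, map_C, ← algebraMap_eq, AlgHom.commutes, Algebra.algebraMap_eq_smul_one]

theorem dunklPoly_X (c : ReflClass W → R) (j : Fin n) : dunklPoly c (X j) = dunkl c j := by
  obtain ⟨φ, hX, h⟩ := exists_dunklPoly_algHom c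
  rw [h, map_X, hX]

/-- The additive map `p ↦ ∇_p`. -/
def dunklPolyHom (c : ReflClass W → R) : Poly n ℂ →+ Module.End R (Poly n R) :=
  AddMonoidHom.mk' (dunklPoly c) (dunklPoly_add c)

theorem dunklPoly_sum (c : ReflClass W → R) {ι : Type*} (s : Finset ι) (f : ι → Poly n ℂ) :
    dunklPoly c (∑ i ∈ s, f i) = ∑ i ∈ s, dunklPoly c (f i) :=
  map_sum (dunklPolyHom c) f s

theorem dunklPoly_zero (c : ReflClass W → R) : dunklPoly c (0 : Poly n ℂ) = 0 :=
  map_zero (dunklPolyHom c)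

theorem act_dunklPoly (c : ReflClass W → R) (w : W) (p : Poly n ℂ) (q : Poly n R) :
    act R w.1 (dunklPoly c p q) = dunklPoly c (act ℂ w.1 p) (act R w.1 q) := by
  induction p using MvPolynomial.induction_on generalizing q with
  | C a =>
    rw [act_C, dunklPoly_C, LinearMap.smul_apply, LinearMap.smul_apply, act_smul]
    rfl
  | add p p' hp hp' =>
    rw [map_add, dunklPoly_add, dunklPoly_add, LinearMap.add_apply, LinearMap.add_apply, map_add,
      hp, hp']
  | mul_X p j hp =>
    rw [map_mul, dunklPoly_mul, dunklPoly_mul, Module.End.mul_apply, Module.End.mul_apply, hp,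
      dunklPoly_X, act_dunkl, act_X, dunklPoly_sum, LinearMap.sum_apply]
    congr 1
    refine Finset.sum_congr rfl fun i _ => ?_
    rw [dunklPoly_mul, dunklPoly_C, dunklPoly_X, smul_mul_assoc, one_mul, LinearMap.smul_apply]
    rfl

theorem dunklPoly_mem_invariants (c : ReflClass W → R) {p : Poly n ℂ} {q : Poly n R}
    (hp : p ∈ invariants ℂ W) (hq : q ∈ invariants R W) :
    dunklPoly c p q ∈ invariants R W := fun w hw => by
  rw [act_dunklPoly c ⟨w, hw⟩, hp w hw, hq w hw]

/-- Euler's identity writes (m + 1) q as ∑ X_k ∂_k q, and the commutation relation reduces each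
summand to degree m. The truncated m - 1 is harmless at m = 0, where constants are killed. -/
theorem dunkl_isHomogeneous (c : ReflClass W → R) (j : Fin n) :
    ∀ (m : ℕ) (q : Poly n R), q.IsHomogeneous m → (dunkl c j q).IsHomogeneous (m - 1) := by
  intro m
  induction m with
  | zero =>
    intro q hq
    rw [isHomogeneous_zero_eq_C hq, dunkl_C]
    exact isHomogeneous_zero _ _ _
  | succ m ih =>
    intro q hq
    rw [Nat.add_sub_cancel]
    have key : ∀ k (p : Poly n R), p.IsHomogeneous m →
        (dunkl c j (X k * p)).IsHomogeneous m := by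
      intro k p hp
      rw [dunkl_X_mul]
      refine ((?_ : IsHomogeneous _ m).add (isHomogeneous_smul _ hp)).sub
        (IsHomogeneous.sum _ _ _ fun s _ =>
          isHomogeneous_smul _ (isHomogeneous_smul _ (isHomogeneous_act _ hp)))
      cases m with
      | zero =>
        rw [isHomogeneous_zero_eq_C hp, dunkl_C, mul_zero]
        exact isHomogeneous_zero _ _ _
      | succ m => simpa [add_comm] using (isHomogeneous_X R k).mul (ih p hp)
    have hEuler := hq.sum_X_mul_pderiv
    have h2 : dunkl c j ((m + 1) • q) = ∑ k, dunkl c j (X k * pderiv k q) := by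
      rw [← hEuler, map_sum]
    have h3 : ((m + 1) • dunkl c j q).IsHomogeneous m := by
      rw [← map_nsmul, h2]
      exact IsHomogeneous.sum _ _ _ fun k _ => key k _ (by simpa using hq.pderiv)
    have h4 : dunkl c j q
        = algebraMap ℂ R ((m + 1 : ℕ) : ℂ)⁻¹ • ((m + 1) • dunkl c j q) := by
      have : algebraMap ℂ R ((m + 1 : ℕ) : ℂ)⁻¹ * ((m + 1 : ℕ) : R) = 1 := by
        have h : ((m + 1 : ℕ) : R) = algebraMap ℂ R ((m + 1 : ℕ) : ℂ) := (map_natCast _ _).symm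
        rw [h, ← map_mul, inv_mul_cancel₀ (by exact_mod_cast m.succ_ne_zero), map_one]
      rw [← Nat.cast_smul_eq_nsmul R, smul_smul, this, one_smul]
    rw [h4]
    exact isHomogeneous_smul _ h3

theorem dunklPoly_isHomogeneous (c : ReflClass W → R) {p : Poly n ℂ} {k m : ℕ}
    (hp : p.IsHomogeneous k) {q : Poly n R} (hq : q.IsHomogeneous m) :
    (dunklPoly c p q).IsHomogeneous (m - k) := by
  obtain ⟨φ, hX, h⟩ := exists_dunklPoly_algHom c
  have key : ∀ (a : Fin n →₀ ℕ) (m : ℕ) (q : Poly n R), q.IsHomogeneous m →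
      (φ (monomial a 1) q).IsHomogeneous (m - a.degree) := by
    intro a
    induction a using Finsupp.induction_linear with
    | zero =>
      intro m q hq
      have : φ (monomial 0 1) = 1 := by
        rw [← map_one φ]
        rfl
      simpa [this] using hq
    | add a b ha hb =>
      intro m q hq
      have : φ (monomial (a + b) 1) = φ (monomial a 1) * φ (monomial b 1) := by
        rw [← map_mul, monomial_mul, one_mul]
      rw [this, Module.End.mul_apply, map_add, add_comm, ← Nat.sub_sub]
      exact ha _ _ (hb _ _ hq)
    | single j e =>
      rw [Finsupp.degree_single, ← X_pow_eq_monomial, map_pow, hX]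
      induction e with
      | zero => simp
      | succ e ih =>
        intro m q hq
        rw [pow_succ, Module.End.mul_apply, add_comm, ← Nat.sub_sub]
        exact ih _ _ (dunkl_isHomogeneous c j _ _ hq)
  rw [h, p.as_sum, map_sum, map_sum, LinearMap.sum_apply]
  refine IsHomogeneous.sum _ _ _ fun a ha => ?_
  rw [map_monomial, ← mul_one (algebraMap ℂ R (coeff a p)), ← smul_eq_mul, ← smul_monomial,
    map_smul, LinearMap.smul_apply]
  refine isHomogeneous_smul _ ?_
  rw [← hp (mem_support_iff.mp ha)]
  convert key a m q hq using 2
  exact (DFunLike.congr_fun Finsupp.degree_eq_weight_one a).symm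

end DunklPoly

/-! ### The pairing ⟨p, q⟩ = (∇_p q)(0) and its nondegeneracy -/

section Pairing

variable {n : ℕ} {R : Type} [CommRing R] [Algebra ℂ R] {W : Subgroup (OrthGroup n)}

/-- The `R`-submodule of `R ⊗ S(V)` generated by a subspace of `S(V)`. -/
def extendScalars (R : Type) [CommRing R] [Algebra ℂ R] (N : Submodule ℂ (Poly n ℂ)) :
    Submodule R (Poly n R) :=
  Submodule.span R (map (algebraMap ℂ R) '' N)

theorem map_mem_extendScalars {N : Submodule ℂ (Poly n ℂ)} {p : Poly n ℂ} (hp : p ∈ N) :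
    map (algebraMap ℂ R) p ∈ extendScalars R N := Submodule.subset_span ⟨p, hp, rfl⟩

theorem map_algebraMap_smul (a : ℂ) (p : Poly n ℂ) :
    map (algebraMap ℂ R) (a • p) = algebraMap ℂ R a • map (algebraMap ℂ R) p := by
  rw [smul_eq_C_mul, map_mul, map_C, smul_eq_C_mul]

theorem exists_eq_sum_of_mem_extendScalars {N : Submodule ℂ (Poly n ℂ)} {ι : Type*} [Fintype ι]
    (b : Module.Basis ι ℂ N) {x : Poly n R} (hx : x ∈ extendScalars R N) :
    ∃ r : ι → R, x = ∑ i, r i • map (algebraMap ℂ R) (b i : Poly n ℂ) := by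
  induction hx using Submodule.span_induction with
  | mem x hx =>
    obtain ⟨p, hp, rfl⟩ := hx
    refine ⟨fun i => algebraMap ℂ R (b.repr ⟨p, hp⟩ i), ?_⟩
    conv_lhs => rw [show p = ((⟨p, hp⟩ : N) : Poly n ℂ) from rfl, ← b.sum_repr ⟨p, hp⟩]
    simp only [Submodule.coe_sum, Submodule.coe_smul, map_sum, map_algebraMap_smul]
  | zero => exact ⟨0, by simp⟩
  | add x y _ _ hx hy =>
    obtain ⟨r, rfl⟩ := hx
    obtain ⟨r', rfl⟩ := hy
    exact ⟨r + r', by simp only [Pi.add_apply, add_smul, Finset.sum_add_distrib]⟩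
  | smul a x _ hx =>
    obtain ⟨r, rfl⟩ := hx
    exact ⟨a • r, by simp only [Pi.smul_apply, smul_eq_mul, mul_smul, Finset.smul_sum]⟩

variable [IsDomain R]

/-- The pairing `⟨p, q⟩ = (∇_p q)(0)`. -/
def pairing (c : ReflClass W → R) (p : Poly n ℂ) : Poly n R →ₗ[R] R :=
  (lcoeff R 0).comp (dunklPoly c p)

theorem pairing_apply (c : ReflClass W → R) (p : Poly n ℂ) (q : Poly n R) :
    pairing c p q = constantCoeff (dunklPoly c p q) := rfl

/-- The Gram matrix of the pairing. -/
def gram (c : ReflClass W → R) {N : Submodule ℂ (Poly n ℂ)} {ι : Type*} (b : ι → N) :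
    Matrix ι ι R :=
  Matrix.of fun i j => pairing c (b i : Poly n ℂ) (map (algebraMap ℂ R) (b j : Poly n ℂ))

theorem gram_mulVec (c : ReflClass W → R) {N : Submodule ℂ (Poly n ℂ)} {ι : Type*}
    [Fintype ι] (b : ι → N) (r : ι → R) (i : ι) : (gram c b).mulVec r i
      = pairing c (b i : Poly n ℂ) (∑ j, r j • map (algebraMap ℂ R) (b j : Poly n ℂ)) := by
  simp only [Matrix.mulVec, dotProduct, gram, Matrix.of_apply, map_sum, map_smul, smul_eq_mul,
    mul_comm]

variable [Fintype (Refl W)]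

theorem pairing_mul (c : ReflClass W → R) (p p' : Poly n ℂ) (q : Poly n R) :
    pairing c (p * p') q = pairing c p (dunklPoly c p' q) := by
  rw [pairing_apply, pairing_apply, dunklPoly_mul, Module.End.mul_apply]

theorem pairing_smul (c : ReflClass W → R) (a : ℂ) (p : Poly n ℂ) (q : Poly n R) :
    pairing c (a • p) q = algebraMap ℂ R a * pairing c p q := by
  rw [smul_eq_C_mul, pairing_apply, pairing_apply, dunklPoly_mul, dunklPoly_C, smul_mul_assoc,
    one_mul, LinearMap.smul_apply, smul_eq_C_mul, map_mul, constantCoeff_C]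

theorem pairing_sum (c : ReflClass W → R) {ι : Type*} (s : Finset ι) (f : ι → Poly n ℂ)
    (q : Poly n R) : pairing c (∑ i ∈ s, f i) q = ∑ i ∈ s, pairing c (f i) q := by
  simp only [pairing_apply, dunklPoly_sum, LinearMap.sum_apply, map_sum]

theorem map_dunkl (ε : R →ₐ[ℂ] ℂ) {c : ReflClass W → R} (hc : ∀ C, ε (c C) = 0) (j : Fin n)
    (q : Poly n R) : map (ε : R →+* ℂ) (dunkl c j q) = pderiv j (map (ε : R →+* ℂ) q) := by
  have h : ∀ s : Refl W, map (ε : R →+* ℂ)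
      (c s.cls • realTo R (s.root j) • divDiff s q) = 0 := fun s => by
    simp [smul_eq_C_mul, hc]
  rw [dunkl_apply, map_sub, map_sum, Finset.sum_eq_zero fun s _ => h s, sub_zero, pderiv_map]

/-- At zero parameters ∇_p is p(∂), for which distinct monomials are orthogonal and x^a has square
a!. The proof removes one variable at a time from a monomial. -/
theorem apply_pairing (ε : R →ₐ[ℂ] ℂ) {c : ReflClass W → R} (hc : ∀ C, ε (c C) = 0)
    (p : Poly n ℂ) (q : Poly n R) :
    ε (pairing c p q) = ∑ a ∈ p.support,
      coeff a p * (∏ i, ((a i).factorial : ℂ)) * coeff a (map (ε : R →+* ℂ) q) := by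
  have key : ∀ (a : Fin n →₀ ℕ) (r : ℂ) (q : Poly n R), ε (pairing c (monomial a r) q)
      = r * (∏ i, ((a i).factorial : ℂ)) * coeff a (map (ε : R →+* ℂ) q) := by
    intro a
    induction hd : a.degree generalizing a with
    | zero =>
      intro r q
      obtain rfl : a = 0 := (Finsupp.degree_eq_zero_iff a).mp hd
      rw [show monomial (0 : Fin n →₀ ℕ) r = r • (1 : Poly n ℂ) by
        rw [smul_eq_C_mul, mul_one]; rfl, pairing_smul, pairing_apply, ← C_1, dunklPoly_C]
      simp [constantCoeff_eq, coeff_map, mul_comm]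
    | succ d ih =>
      intro r q
      obtain ⟨j, hj⟩ : ∃ j, a j ≠ 0 := by
        by_contra! h
        have : a = 0 := Finsupp.ext h
        simp [this] at hd
      obtain ⟨b, rfl⟩ : ∃ b, a = b + Finsupp.single j 1 :=
        ⟨a - Finsupp.single j 1, (tsub_add_cancel_of_le (by
          simpa [Nat.one_le_iff_ne_zero] using hj)).symm⟩
      have hb : b.degree = d := by simpa using hd
      have h1 : monomial (b + Finsupp.single j 1) r = monomial b r * X j := by
        rw [X, monomial_mul, mul_one]
      rw [h1, pairing_mul, dunklPoly_X, ih b hb, map_dunkl ε hc, coeff_pderiv]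
      have h2 : ∏ i, (((b + Finsupp.single j 1 : Fin n →₀ ℕ) i).factorial : ℂ)
          = (∏ i, ((b i).factorial : ℂ)) * (b j + 1) := by
        rw [← Finset.mul_prod_erase _ _ (Finset.mem_univ j),
          ← Finset.mul_prod_erase _ (fun i => ((b i).factorial : ℂ)) (Finset.mem_univ j)]
        have h3 : ∀ i ∈ Finset.univ.erase j,
            (((b + Finsupp.single j 1 : Fin n →₀ ℕ) i).factorial : ℂ) = ((b i).factorial : ℂ) := by
          intro i hi
          have : j ≠ i := (Finset.ne_of_mem_erase hi).symm
          simp [this]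
        rw [Finset.prod_congr rfl h3]
        simp only [Finsupp.add_apply, Finsupp.single_eq_same, Nat.factorial_succ, Nat.cast_mul,
          Nat.cast_add, Nat.cast_one]
        ring
      rw [h2]
      ring
  conv_lhs => rw [p.as_sum, pairing_sum, map_sum]
  exact Finset.sum_congr rfl fun a _ => key _ _ _

/-- The pairing is positive definite where the parameters vanish. -/
theorem apply_pairing_conj_ne_zero (ε : R →ₐ[ℂ] ℂ) {c : ReflClass W → R}
    (hc : ∀ C, ε (c C) = 0) {p : Poly n ℂ} (hp : p ≠ 0) :
    ε (pairing c (map (starRingEnd ℂ) p) (map (algebraMap ℂ R) p)) ≠ 0 := by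
  have h1 : map (ε : R →+* ℂ) (map (algebraMap ℂ R) p) = p := by
    rw [map_map]
    have : ((ε : R →+* ℂ).comp (algebraMap ℂ R)) = RingHom.id ℂ := RingHom.ext fun a => by simp
    rw [this, map_id]
  rw [apply_pairing ε hc, h1, support_map_of_injective _ (starRingEnd ℂ).injective]
  have h2 : ∀ a : Fin n →₀ ℕ, coeff a (map (starRingEnd ℂ) p) * (∏ i, ((a i).factorial : ℂ)) *
      coeff a p = (((∏ i, (a i).factorial : ℕ) * Complex.normSq (coeff a p) : ℝ) : ℂ) := by
    intro a
    rw [coeff_map]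
    push_cast
    rw [Complex.normSq_eq_conj_mul_self]
    ring
  simp only [h2]
  rw [← Complex.ofReal_sum]
  refine Complex.ofReal_ne_zero.mpr (ne_of_gt (Finset.sum_pos (fun a ha => ?_)
    (support_nonempty.mpr hp)))
  refine mul_pos ?_ (Complex.normSq_pos.mpr (mem_support_iff.mp ha))
  exact_mod_cast Finset.prod_pos fun i _ => Nat.factorial_pos _

/-- If the determinant were zero, it would vanish at zero parameters as well. A null vector there is
a nonzero q ∈ N orthogonal to all of N, in particular to its conjugate, against positivity. -/
theorem det_gram_ne_zero (ε : R →ₐ[ℂ] ℂ) {c : ReflClass W → R} (hc : ∀ C, ε (c C) = 0)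
    {N : Submodule ℂ (Poly n ℂ)} (hN : ∀ p ∈ N, map (starRingEnd ℂ) p ∈ N)
    {ι : Type*} [Fintype ι] [DecidableEq ι] (b : Module.Basis ι ℂ N) : (gram c b).det ≠ 0 := by
  intro h0
  have h1 : ((ε : R →+* ℂ).mapMatrix (gram c b)).det = 0 := by
    rw [← RingHom.map_det, h0, map_zero]
  obtain ⟨v, hv, hv0⟩ := Matrix.exists_mulVec_eq_zero_iff.mpr h1
  let q : N := ∑ j, v j • b j
  have hq : (q : Poly n ℂ) ≠ 0 := by
    intro h
    have hq0 : q = 0 := Subtype.ext h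
    exact hv (funext fun j => Fintype.linearIndependent_iff.mp b.linearIndependent v hq0 j)
  refine apply_pairing_conj_ne_zero ε hc hq ?_
  have h2 : ∀ i, ε (pairing c (b i : Poly n ℂ) (map (algebraMap ℂ R) (q : Poly n ℂ))) = 0 := by
    intro i
    have := congrFun hv0 i
    simp only [Matrix.mulVec, dotProduct, RingHom.mapMatrix_apply, Matrix.map_apply, gram,
      Matrix.of_apply, Pi.zero_apply] at this
    rw [← this]
    simp only [q, Submodule.coe_sum, Submodule.coe_smul, map_sum, map_algebraMap_smul, map_smul,
      smul_eq_mul, map_mul, AlgHom.commutes]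
    exact Finset.sum_congr rfl fun j _ => mul_comm _ _
  have h3 := congrArg (Subtype.val) (b.sum_repr ⟨_, hN q q.2⟩)
  simp only [Submodule.coe_sum, Submodule.coe_smul] at h3
  rw [← h3, pairing_sum, map_sum]
  refine Finset.sum_eq_zero fun i _ => ?_
  rw [pairing_smul, map_mul, h2, mul_zero]

theorem pairing_eq_zero_of_basis (c : ReflClass W → R) {N : Submodule ℂ (Poly n ℂ)} {ι : Type*}
    [Fintype ι] (b : Module.Basis ι ℂ N) {x : Poly n R}
    (h : ∀ i, pairing c (b i : Poly n ℂ) x = 0) {p : Poly n ℂ} (hp : p ∈ N) :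
    pairing c p x = 0 := by
  have h3 := congrArg (Subtype.val) (b.sum_repr ⟨p, hp⟩)
  simp only [Submodule.coe_sum, Submodule.coe_smul] at h3
  rw [← h3, pairing_sum]
  exact Finset.sum_eq_zero fun i _ => by rw [pairing_smul, h, mul_zero]

/-- The pairing is nondegenerate on the extension of a subspace that is stable under complex
conjugation. -/
theorem eq_zero_of_pairing_eq_zero (ε : R →ₐ[ℂ] ℂ) {c : ReflClass W → R}
    (hc : ∀ C, ε (c C) = 0) (N : Submodule ℂ (Poly n ℂ)) [FiniteDimensional ℂ N]
    (hN : ∀ p ∈ N, map (starRingEnd ℂ) p ∈ N) {x : Poly n R} (hx : x ∈ extendScalars R N)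
    (h : ∀ p ∈ N, pairing c p x = 0) : x = 0 := by
  classical
  let b := Module.finBasis ℂ N
  obtain ⟨r, rfl⟩ := exists_eq_sum_of_mem_extendScalars b hx
  have h1 : (gram c b).mulVec r = 0 := funext fun i => by
    rw [gram_mulVec, h _ (b i).2, Pi.zero_apply]
  have h2 := Matrix.eq_zero_of_mulVec_eq_zero (det_gram_ne_zero ε hc hN b) h1
  simp [h2]

/-- Orthogonal projection, up to a denominator. -/
theorem exists_pairing_sub_eq_zero (ε : R →ₐ[ℂ] ℂ) {c : ReflClass W → R}
    (hc : ∀ C, ε (c C) = 0) (N : Submodule ℂ (Poly n ℂ)) [FiniteDimensional ℂ N]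
    (hN : ∀ p ∈ N, map (starRingEnd ℂ) p ∈ N) :
    ∃ D : R, D ≠ 0 ∧ ∀ x : Poly n R, ∃ y ∈ extendScalars R N,
      ∀ p ∈ N, pairing c p (D • x - y) = 0 := by
  classical
  let b := Module.finBasis ℂ N
  refine ⟨(gram c b).det, det_gram_ne_zero ε hc hN b, fun x => ?_⟩
  -- Cramer's rule: the adjugate replaces the inverse Gram matrix, so the coordinates stay in R and
  -- the denominator is the Gram determinant.
  let r := (gram c b).adjugate.mulVec fun i => pairing c (b i : Poly n ℂ) x
  refine ⟨∑ j, r j • map (algebraMap ℂ R) (b j : Poly n ℂ), Submodule.sum_mem _ fun j _ =>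
    Submodule.smul_mem _ _ (map_mem_extendScalars (b j).2), fun p hp => ?_⟩
  refine pairing_eq_zero_of_basis c b (fun i => ?_) hp
  rw [map_sub, ← gram_mulVec, Matrix.mulVec_mulVec, Matrix.mul_adjugate, Matrix.smul_mulVec,
    Matrix.one_mulVec, map_smul]
  simp

end Pairing

/-! ### Homogeneous ideals and weighted homogeneous polynomials -/

section Homogeneous

variable {σ ι R : Type*} [CommRing R]

attribute [local instance] MvPolynomial.gradedAlgebra in
theorem homogeneousComponent_mem_span {s : Set (MvPolynomial σ R)}
    (hs : ∀ p ∈ s, ∃ m, p.IsHomogeneous m) {p : MvPolynomial σ R} (hp : p ∈ Ideal.span s)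
    (m : ℕ) : homogeneousComponent m p ∈ Ideal.span s :=
  homogeneousComponent_mem_of_mem (Ideal.homogeneous_span _ s hs) hp m

theorem isHomogeneous_aeval {d : ι → ℕ} {f : ι → MvPolynomial σ R}
    (hf : ∀ i, (f i).IsHomogeneous (d i)) {H : MvPolynomial ι R} {m : ℕ}
    (hH : IsWeightedHomogeneous d H m) : (aeval f H).IsHomogeneous m := by
  rw [H.as_sum, map_sum]
  refine IsHomogeneous.sum _ _ _ fun a ha => ?_
  rw [aeval_monomial, ← Algebra.smul_def, Finsupp.prod]
  refine (homogeneousSubmodule σ R m).smul_mem _ ?_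
  have h := IsHomogeneous.prod a.support (fun i => f i ^ a i) (fun i => d i * a i)
    fun i _ => (hf i).pow _
  rw [← hH (mem_support_iff.mp ha), Finsupp.weight_apply, Finsupp.sum]
  rw [mem_homogeneousSubmodule]
  simpa only [smul_eq_mul, mul_comm] using h

theorem homogeneousComponent_aeval {d : ι → ℕ} {f : ι → MvPolynomial σ R}
    (hf : ∀ i, (f i).IsHomogeneous (d i)) (H : MvPolynomial ι R) (m : ℕ) :
    homogeneousComponent m (aeval f H) = aeval f (weightedHomogeneousComponent d m H) := by
  conv_lhs => rw [H.as_sum]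
  conv_rhs => rw [H.as_sum]
  simp only [map_sum]
  refine Finset.sum_congr rfl fun a _ => ?_
  have h := isWeightedHomogeneous_monomial d a (coeff a H) rfl
  rw [homogeneousComponent_of_mem (isHomogeneous_aeval hf h), weightedHomogeneousComponent_of_mem h]
  split_ifs
  · rfl
  · rw [map_zero]

theorem exists_weightedHomogeneousComponent_ne_zero (d : ι → ℕ) {H : MvPolynomial ι R}
    (hH : H ≠ 0) : ∃ m, weightedHomogeneousComponent d m H ≠ 0 := by
  classical
  obtain ⟨a, ha⟩ := ne_zero_iff.mp hH
  refine ⟨Finsupp.weight d a, fun h => ha ?_⟩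
  have := congrArg (coeff a) h
  rwa [coeff_weightedHomogeneousComponent, if_pos rfl, coeff_zero] at this

theorem pderiv_isWeightedHomogeneous {d : ι → ℕ} {H : MvPolynomial ι R} {m : ℕ}
    (hH : IsWeightedHomogeneous d H m) (i : ι) :
    IsWeightedHomogeneous d (pderiv i H) (m - d i) := by
  intro a ha
  rw [coeff_pderiv] at ha
  have := hH (left_ne_zero_of_mul ha)
  rw [map_add, Finsupp.weight_single, one_smul] at this
  omega

theorem le_of_pderiv_ne_zero {d : ι → ℕ} {H : MvPolynomial ι R} {m : ℕ}
    (hH : IsWeightedHomogeneous d H m) {i : ι} (hi : pderiv i H ≠ 0) : d i ≤ m := by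
  obtain ⟨a, ha⟩ := ne_zero_iff.mp hi
  rw [coeff_pderiv] at ha
  have := hH (left_ne_zero_of_mul ha)
  rw [map_add, Finsupp.weight_single, one_smul] at this
  omega

theorem eq_C_of_pderiv_eq_zero [IsDomain R] [CharZero R] {H : MvPolynomial ι R}
    (h : ∀ i, pderiv i H = 0) : H = C (coeff 0 H) := by
  classical
  ext a
  rw [coeff_C]
  split_ifs with h0
  · rw [h0]
  · obtain ⟨i, hi⟩ : ∃ i, a i ≠ 0 := by
      by_contra! h
      exact h0 (Finsupp.ext h).symm
    obtain ⟨b, rfl⟩ : ∃ b, a = b + Finsupp.single i 1 :=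
      ⟨a - Finsupp.single i 1, (tsub_add_cancel_of_le (by
        simpa [Nat.one_le_iff_ne_zero] using hi)).symm⟩
    have := congrArg (coeff b) (h i)
    rw [coeff_pderiv, coeff_zero, mul_eq_zero] at this
    exact this.resolve_right (by exact_mod_cast (b i).succ_ne_zero)

theorem pderiv_aeval [Fintype ι] (f : ι → MvPolynomial σ R) (k : σ) (H : MvPolynomial ι R) :
    pderiv k (aeval f H) = ∑ i, aeval f (pderiv i H) * pderiv k (f i) := by
  classical
  induction H using MvPolynomial.induction_on with
  | C a => simp [algebraMap_eq]
  | add p q hp hq => simp only [map_add, hp, hq, add_mul, Finset.sum_add_distrib]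
  | mul_X p j hp =>
    have : ∀ i, aeval f (pderiv i (p * X j)) * pderiv k (f i)
        = f j * (aeval f (pderiv i p) * pderiv k (f i))
          + if i = j then aeval f p * pderiv k (f j) else 0 := by
      intro i
      rw [pderiv_mul, pderiv_X]
      rcases eq_or_ne i j with rfl | h
      · simp
        ring
      · simp [h]
        ring
    simp only [this, Finset.sum_add_distrib, ← Finset.mul_sum, ← hp]
    rw [map_mul, aeval_X, pderiv_mul]
    simp
    ring

/-- A finite family contains a minimal system of generators of the ideal that it generates. -/
theorem exists_minimal_generators [Fintype ι] {A : Type*} [CommRing A] (h : ι → A) :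
    ∃ J : Finset ι, Ideal.span (h '' J) = Ideal.span (Set.range h) ∧
      ∀ j ∈ J, h j ∉ Ideal.span (h '' {i | i ∈ J ∧ i ≠ j}) := by
  classical
  obtain ⟨J, hJ, hmin⟩ := Finset.exists_min_image
    (Finset.univ.filter fun J : Finset ι => Ideal.span (h '' J) = Ideal.span (Set.range h))
    Finset.card ⟨Finset.univ, by simp⟩
  rw [Finset.mem_filter] at hJ
  refine ⟨J, hJ.2, fun j hj hmem => ?_⟩
  have hset : {i | i ∈ J ∧ i ≠ j} = ((J.erase j : Finset ι) : Set ι) := by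
    ext i
    simp [and_comm]
  rw [hset] at hmem
  have h1 : Ideal.span (h '' (J.erase j : Finset ι)) = Ideal.span (h '' J) := by
    refine le_antisymm (Ideal.span_mono (Set.image_mono (by simp))) ?_
    rw [Ideal.span_le]
    rintro _ ⟨i, hi, rfl⟩
    rcases eq_or_ne i j with rfl | hij
    · exact hmem
    · exact Ideal.subset_span ⟨i, by simpa [hij] using hi, rfl⟩
  have h2 := hmin (J.erase j) (Finset.mem_filter.mpr ⟨Finset.mem_univ _, h1.trans hJ.2⟩)
  exact absurd (Finset.card_erase_lt_of_mem hj) (not_lt.mpr h2)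

end Homogeneous

/-! ### The theorem of Chevalley -/

section Chevalley

variable {n : ℕ} {W : Subgroup (OrthGroup n)}

variable (W) in
/-- The ideal generated by the homogeneous invariants of positive degree. -/
def invariantIdeal : Ideal (Poly n ℂ) :=
  Ideal.span {p | p ∈ invariants ℂ W ∧ ∃ m, m ≠ 0 ∧ p.IsHomogeneous m}

theorem constantCoeff_of_mem_invariantIdeal {p : Poly n ℂ} (hp : p ∈ invariantIdeal W) :
    constantCoeff p = 0 := by
  have h : invariantIdeal W ≤ RingHom.ker (constantCoeff : Poly n ℂ →+* ℂ) := by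
    rw [invariantIdeal, Ideal.span_le]
    rintro q ⟨-, m, hm, hq⟩
    exact constantCoeff_eq_zero_of_isHomogeneous hq hm
  exact h hp

theorem act_mem_invariantIdeal {p : Poly n ℂ} (hp : p ∈ invariantIdeal W) {w : OrthGroup n}
    (hw : w ∈ W) : act ℂ w p ∈ invariantIdeal W := by
  have h : invariantIdeal W ≤ (invariantIdeal W).comap (act ℂ w) := by
    conv_lhs => rw [invariantIdeal]
    rw [Ideal.span_le]
    rintro q ⟨hq, m, hm, hq'⟩
    change act ℂ w q ∈ invariantIdeal W
    rw [hq w hw]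
    exact Ideal.subset_span ⟨hq, m, hm, hq'⟩
  exact h hp

theorem mem_invariantIdeal_of_invariant {p : Poly n ℂ} (hp : p ∈ invariants ℂ W)
    (h0 : constantCoeff p = 0) : p ∈ invariantIdeal W := by
  rw [← sum_homogeneousComponent p]
  refine Ideal.sum_mem _ fun m _ => ?_
  rcases eq_or_ne m 0 with rfl | hm
  · rw [homogeneousComponent_zero, ← constantCoeff_eq, h0, map_zero]
    exact Ideal.zero_mem _
  · exact Ideal.subset_span ⟨homogeneousComponent_mem_invariants hp m, m, hm,
      homogeneousComponent_isHomogeneous m p⟩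

/-- Linearity over the invariants lets a relation ∑ gᵢ hᵢ = 0 with invariant gᵢ pass to the divided
differences of the hᵢ, which have smaller degree. -/
theorem divDiff_mul_of_invariant (s : Refl W) {g : Poly n ℂ} (hg : g ∈ invariants ℂ W)
    (h : Poly n ℂ) : divDiff s (g * h) = g * divDiff s h := by
  apply mul_left_cancel₀ (linForm_ne_zero (R := ℂ) s.hasRoot.1)
  rw [linForm_mul_divDiff, map_mul, hg _ s.1.2, mul_left_comm, linForm_mul_divDiff]
  ring

theorem totalDegree_divDiff_lt (s : Refl W) {h : Poly n ℂ} (hne : divDiff s h ≠ 0) :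
    (divDiff s h).totalDegree < h.totalDegree := by
  have hl := linForm_ne_zero (R := ℂ) s.hasRoot.1
  have h1 := totalDegree_mul_of_isDomain hl hne
  rw [linForm_mul_divDiff, (linForm_isHomogeneous (R := ℂ) s.root).totalDegree hl] at h1
  have h2 : (h - act ℂ s.1.1 h).totalDegree ≤ h.totalDegree :=
    (totalDegree_sub _ _).trans (max_le le_rfl (totalDegree_act_le _ _))
  omega

/-- The ideal is W-stable, so the elements of W that fix h modulo it are closed under products and
inverses. -/
theorem sub_act_mem_of_reflections (hW : IsReflectionGroup W) {h : Poly n ℂ}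
    (hs : ∀ s : Refl W, h - act ℂ s.1.1 h ∈ invariantIdeal W) {w : OrthGroup n} (hw : w ∈ W) :
    h - act ℂ w h ∈ invariantIdeal W := by
  have key : ∀ w ∈ Subgroup.closure {w | w ∈ W ∧ IsReflection w},
      h - act ℂ w h ∈ invariantIdeal W := by
    intro w hw
    induction hw using Subgroup.closure_induction with
    | mem x hx => exact hs ⟨⟨x, hx.1⟩, hx.2⟩
    | one => simp [act_one]
    | mul x y hx _ hx' hy' =>
      rw [hW] at hx
      have : h - act ℂ (x * y) h = (h - act ℂ x h) + act ℂ x (h - act ℂ y h) := by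
        rw [act_mul, map_sub]
        ring
      rw [this]
      exact add_mem hx' (act_mem_invariantIdeal hy' hx)
    | inv x hx hx' =>
      rw [hW] at hx
      have : h - act ℂ x⁻¹ h = -act ℂ x⁻¹ (h - act ℂ x h) := by
        rw [map_sub, ← act_mul, inv_mul_cancel, act_one]
        ring
      rw [this]
      exact neg_mem (act_mem_invariantIdeal hx' (inv_mem hx))
  exact key w (by rwa [hW])

/-- If `∑ gᵢ hᵢ = 0` with homogeneous invariants `gᵢ`, of which `g₁` is not in the ideal
generated by the others, then `h₁` is in the ideal generated by the invariants of positive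
degree. -/
theorem mem_invariantIdeal_of_sum_eq_zero [Fintype W] (hW : IsReflectionGroup W) {ι : Type*}
    {J : Finset ι} {g : ι → Poly n ℂ} {e : ι → ℕ} (hg : ∀ i, (g i).IsHomogeneous (e i))
    (hinv : ∀ i, g i ∈ invariants ℂ W) {j : ι} (hj : j ∈ J)
    (hnot : g j ∉ Ideal.span (g '' {i | i ∈ J ∧ i ≠ j})) (h : ι → Poly n ℂ)
    (hsum : ∑ i ∈ J, g i * h i = 0) : h j ∈ invariantIdeal W := by
  classical
  induction hd : (h j).totalDegree using Nat.strong_induction_on generalizing h with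
  | _ D ih =>
  -- If h_j had a nonzero constant term, the component of degree e_j of h_j g_j would put g_j in the
  -- ideal of the others.
  have h0 : constantCoeff (h j) = 0 := by
    by_contra h0
    refine hnot ?_
    have h1 : h j * g j ∈ Ideal.span (g '' {i | i ∈ J ∧ i ≠ j}) := by
      rw [← Finset.add_sum_erase _ _ hj, add_eq_zero_iff_eq_neg] at hsum
      rw [mul_comm, hsum]
      refine neg_mem (Ideal.sum_mem _ fun i hi => Ideal.mul_mem_right _ _ (Ideal.subset_span
        ⟨i, ⟨Finset.mem_of_mem_erase hi, Finset.ne_of_mem_erase hi⟩, rfl⟩))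
    have h2 := homogeneousComponent_mem_span (by
      rintro _ ⟨i, -, rfl⟩
      exact ⟨_, hg i⟩) h1 (0 + e j)
    rw [homogeneousComponent_mul_of_isHomogeneous (hg j), homogeneousComponent_zero] at h2
    have h3 := Ideal.mul_mem_left _ (C (constantCoeff (h j))⁻¹) h2
    rwa [← mul_assoc, ← map_mul, ← constantCoeff_eq, inv_mul_cancel₀ h0, map_one, one_mul] at h3
  -- Divided differences of the relation have a j-th factor of smaller degree, so by induction h_j
  -- is fixed by every reflection modulo the ideal.
  have hs : ∀ s : Refl W, h j - act ℂ s.1.1 (h j) ∈ invariantIdeal W := by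
    intro s
    rw [← linForm_mul_divDiff]
    refine Ideal.mul_mem_left _ _ ?_
    by_cases hne : divDiff s (h j) = 0
    · rw [hne]
      exact Ideal.zero_mem _
    · refine ih _ (hd ▸ totalDegree_divDiff_lt s hne) (fun i => divDiff s (h i)) ?_ rfl
      have := congrArg (divDiff (R := ℂ) s) hsum
      simpa only [map_sum, map_zero, divDiff_mul_of_invariant s (hinv _)] using this
  -- Hence h_j is congruent to its average, an invariant without constant term.
  have hR : h j - reynolds ℂ W (h j) ∈ invariantIdeal W := by
    have h1 : h j - reynolds ℂ W (h j)
        = C (Fintype.card W : ℂ)⁻¹ * ∑ w : W, (h j - act ℂ w.1 (h j)) := by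
      rw [Finset.sum_sub_distrib, mul_sub, reynolds_apply, smul_eq_C_mul, Finset.sum_const,
        Finset.card_univ, nsmul_eq_mul, ← mul_assoc, ← map_natCast C, ← map_mul, inv_mul_cancel₀
        (by exact_mod_cast Fintype.card_ne_zero), map_one, one_mul]
      rfl
    rw [h1]
    exact Ideal.mul_mem_left _ _ (Ideal.sum_mem _ fun w _ =>
      sub_act_mem_of_reflections hW hs w.2)
  have hR0 : constantCoeff (reynolds ℂ W (h j)) = 0 := by
    have := constantCoeff_of_mem_invariantIdeal hR
    rwa [map_sub, h0, zero_sub, neg_eq_zero] at this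
  have := add_mem hR (mem_invariantIdeal_of_invariant (reynolds_mem (h j)) hR0)
  rwa [sub_add_cancel] at this

theorem aeval_mem_invariants {ι : Type*} {f : ι → Poly n ℂ} (hf : ∀ i, f i ∈ invariants ℂ W)
    (H : MvPolynomial ι ℂ) : aeval f H ∈ invariants ℂ W := by
  intro w hw
  rw [comp_aeval_apply]
  congr 2
  funext i
  exact hf i w hw

variable {ι : Type} [Fintype ι] {f : ι → Poly n ℂ} {d : ι → ℕ}

/-- Homogeneous generators of the ideal of positive invariants generate the algebra of
invariants. -/
theorem adjoin_eq_invariants [Fintype W] (hf : ∀ i, f i ∈ invariants ℂ W)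
    (hd : ∀ i, (f i).IsHomogeneous (d i)) (hd0 : ∀ i, d i ≠ 0)
    (hspan : Ideal.span (Set.range f) = invariantIdeal W) :
    Algebra.adjoin ℂ (Set.range f) = invariants ℂ W := by
  refine le_antisymm (Algebra.adjoin_le (by rintro _ ⟨i, rfl⟩; exact hf i)) ?_
  have key : ∀ (m : ℕ) (q : Poly n ℂ), q ∈ invariants ℂ W → q.IsHomogeneous m →
      q ∈ Algebra.adjoin ℂ (Set.range f) := by
    intro m
    induction m using Nat.strong_induction_on with
    | _ m ih =>
    intro q hq hm
    rcases eq_or_ne m 0 with rfl | hm0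
    · rw [isHomogeneous_zero_eq_C hm]
      exact Subalgebra.algebraMap_mem _ _
    have hqI : q ∈ Ideal.span (Set.range f) := by
      rw [hspan]
      exact Ideal.subset_span ⟨hq, m, hm0, hm⟩
    obtain ⟨h, hh⟩ := Ideal.mem_span_range_iff_exists_fun.mp hqI
    -- Hilbert's argument: averaging makes the coefficients of the f_i invariant, and they have
    -- smaller degree than q.
    have h1 : q = ∑ i, reynolds ℂ W (homogeneousComponent m (h i * f i)) := by
      rw [← map_sum, ← map_sum, hh, homogeneousComponent_eq_self hm, reynolds_of_mem hq]
    rw [h1]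
    refine Subalgebra.sum_mem _ fun i _ => ?_
    rcases lt_or_ge m (d i) with hlt | hge
    · rw [homogeneousComponent_mul_of_lt (hd i) _ hlt, map_zero]
      exact Subalgebra.zero_mem _
    · obtain ⟨k, rfl⟩ : ∃ k, m = k + d i := ⟨m - d i, by omega⟩
      rw [homogeneousComponent_mul_of_isHomogeneous (hd i), mul_comm, reynolds_mul (hf i)]
      refine Subalgebra.mul_mem _ (Algebra.subset_adjoin ⟨i, rfl⟩) (ih k ?_ _ (reynolds_mem _)
        (isHomogeneous_reynolds (homogeneousComponent_isHomogeneous _ _)))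
      have := hd0 i
      omega
  intro q hq
  rw [← sum_homogeneousComponent q]
  exact Subalgebra.sum_mem _ fun m _ => key m _ (homogeneousComponent_mem_invariants hq m)
    (homogeneousComponent_isHomogeneous m q)

/-- A minimal system of homogeneous generators of the ideal of positive invariants is
algebraically independent. -/
theorem algebraicIndependent_of_minimal [Fintype W] (hW : IsReflectionGroup W)
    (hf : ∀ i, f i ∈ invariants ℂ W) (hd : ∀ i, (f i).IsHomogeneous (d i)) (hd0 : ∀ i, d i ≠ 0)
    (hspan : Ideal.span (Set.range f) = invariantIdeal W)
    (hmin : ∀ j, f j ∉ Ideal.span (f '' {i | i ≠ j})) : AlgebraicIndependent ℂ f := by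
  classical
  by_contra hdep
  have hex : ∃ m, ∃ H : MvPolynomial ι ℂ, H ≠ 0 ∧ IsWeightedHomogeneous d H m ∧
      aeval f H = 0 := by
    rw [algebraicIndependent_iff] at hdep
    push Not at hdep
    obtain ⟨H, hH, hne⟩ := hdep
    obtain ⟨m, hm⟩ := exists_weightedHomogeneousComponent_ne_zero d hne
    refine ⟨m, _, hm, weightedHomogeneousComponent_isWeightedHomogeneous m H, ?_⟩
    rw [← homogeneousComponent_aeval hd, hH, map_zero]
  obtain ⟨H, hne, hwt, hH⟩ := Nat.find_spec hex
  have hm := fun k => Nat.find_min hex (m := k)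
  generalize Nat.find hex = m at hwt hm
  let h : ι → Poly n ℂ := fun i => aeval f (pderiv i H)
  have hhom : ∀ i, (h i).IsHomogeneous (m - d i) := fun i =>
    isHomogeneous_aeval hd (pderiv_isWeightedHomogeneous hwt i)
  have hinv : ∀ i, h i ∈ invariants ℂ W := fun i => aeval_mem_invariants hf _
  -- By minimality of m, a nonzero ∂_i H cannot vanish at f, its weight being smaller; and if all
  -- ∂_i H are zero, H is a constant, hence zero.
  obtain ⟨i₀, hi₀⟩ : ∃ i, h i ≠ 0 := by
    by_contra! hall
    have hz : ∀ i, pderiv i H = 0 := by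
      intro i
      by_contra hi
      have h1 := le_of_pderiv_ne_zero hwt hi
      exact hm (m - d i) (by have := hd0 i; omega)
        ⟨_, hi, pderiv_isWeightedHomogeneous hwt i, hall i⟩
    have hC := eq_C_of_pderiv_eq_zero hz
    rw [hC, aeval_C, algebraMap_eq, C_eq_zero] at hH
    rw [hH, map_zero] at hC
    exact hne hC
  obtain ⟨J, hJ, hJmin⟩ := exists_minimal_generators h
  obtain ⟨j, hj⟩ : J.Nonempty := by
    rw [Finset.nonempty_iff_ne_empty]
    rintro rfl
    have h1 : h i₀ ∈ Ideal.span (Set.range h) := Ideal.subset_span ⟨i₀, rfl⟩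
    rw [← hJ] at h1
    simp at h1
    exact hi₀ h1
  have hv : ∀ i, ∃ v : ι → Poly n ℂ, h i = ∑ j ∈ J, v j * h j := by
    intro i
    have h1 : h i ∈ Ideal.span (Set.range h) := Ideal.subset_span ⟨i, rfl⟩
    rw [← hJ] at h1
    obtain ⟨v, hv⟩ := (Submodule.mem_span_image_finset_iff_exists_fun _).mp h1
    refine ⟨fun j => if hj : j ∈ J then v ⟨j, hj⟩ else 0, ?_⟩
    rw [← hv, ← Finset.sum_coe_sort J]
    exact Finset.sum_congr rfl fun l _ => by simp
  choose v hv using hv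
  -- Differentiating H(f) = 0 by x_k gives ∑ h_i ∂_k f_i = 0; after expressing every h_i outside J
  -- through J, the coefficient of h_j is u k j.
  let u : Fin n → ι → Poly n ℂ := fun k j =>
    pderiv k (f j) + ∑ i ∈ Jᶜ, v i j * pderiv k (f i)
  have hu : ∀ k, u k j ∈ invariantIdeal W := by
    intro k
    refine mem_invariantIdeal_of_sum_eq_zero hW hhom hinv hj (hJmin j hj) (u k) ?_
    have h1 : ∑ i, h i * pderiv k (f i) = 0 := by
      rw [← pderiv_aeval, hH, map_zero]
    rw [← h1, ← Finset.sum_add_sum_compl J]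
    simp only [u, mul_add, Finset.sum_add_distrib]
    congr 1
    simp only [Finset.mul_sum]
    rw [Finset.sum_comm]
    refine Finset.sum_congr rfl fun i _ => ?_
    rw [hv i, Finset.sum_mul]
    exact Finset.sum_congr rfl fun l _ => by ring
  let K := Ideal.span (f '' {i | i ≠ j})
  have hKhom : ∀ {p}, p ∈ K → ∀ m, homogeneousComponent m p ∈ K := fun hp m =>
    homogeneousComponent_mem_span (by rintro _ ⟨i, -, rfl⟩; exact ⟨_, hd i⟩) hp m
  -- In degree d_j the generator f_j could enter only with the constant term of its coefficient, and
  -- the factor X_k makes that zero.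
  have hK : ∀ k, homogeneousComponent (0 + d j) (X k * u k j) ∈ K := by
    intro k
    have h1 := hu k
    rw [← hspan] at h1
    obtain ⟨a, ha⟩ := Ideal.mem_span_range_iff_exists_fun.mp h1
    rw [← ha, ← Finset.add_sum_erase _ _ (Finset.mem_univ j), mul_add, map_add, ← mul_assoc,
      homogeneousComponent_mul_of_isHomogeneous (hd j), homogeneousComponent_zero]
    simp only [← constantCoeff_eq, map_mul, constantCoeff_X, zero_mul, map_zero, zero_add]
    have h2 := hKhom (Ideal.mul_mem_left K (X k) (Ideal.sum_mem K (t := Finset.univ.erase j)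
      (f := fun i => a i * f i) fun i hi => Ideal.mul_mem_left _ _
      (Ideal.subset_span ⟨i, Finset.ne_of_mem_erase hi, rfl⟩))) (0 + d j)
    simpa only [zero_add] using h2
  -- By Euler's identity the sum over k recovers d_j f_j modulo the other generators, contradicting
  -- minimality.
  have hEuler : ∑ k, X k * u k j = d j • f j + ∑ i ∈ Jᶜ, v i j * (d i • f i) := by
    simp only [u, mul_add, Finset.sum_add_distrib, (hd j).sum_X_mul_pderiv, Finset.mul_sum]
    rw [Finset.sum_comm]
    congr 1
    refine Finset.sum_congr rfl fun i _ => ?_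
    rw [← (hd i).sum_X_mul_pderiv, Finset.mul_sum]
    exact Finset.sum_congr rfl fun l _ => by ring
  have h1 : homogeneousComponent (0 + d j) (∑ k, X k * u k j) ∈ K := by
    rw [map_sum]
    exact Ideal.sum_mem _ fun k _ => hK k
  have h2 : ∑ i ∈ Jᶜ, v i j * (d i • f i) ∈ K := by
    refine Ideal.sum_mem _ fun i hi => Ideal.mul_mem_left _ _ (nsmul_mem ?_ _)
    refine Ideal.subset_span ⟨i, fun hij => Finset.mem_compl.mp hi ?_, rfl⟩
    rwa [hij]
  rw [hEuler, map_add] at h1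
  have h3 := (Submodule.add_mem_iff_left K (hKhom h2 _)).mp h1
  rw [zero_add, homogeneousComponent_eq_self ((homogeneousSubmodule _ _ _).nsmul_mem (hd j) _)]
    at h3
  refine hmin j ?_
  have h4 := Ideal.mul_mem_left K (C (d j : ℂ)⁻¹) h3
  rwa [nsmul_eq_mul, ← mul_assoc, ← map_natCast C, ← map_mul,
    inv_mul_cancel₀ (by exact_mod_cast hd0 j), map_one, one_mul] at h4

theorem isIntegral_invariants [Fintype W] : Algebra.IsIntegral (invariants ℂ W) (Poly n ℂ) := by
  let _ : MulSemiringAction W (Poly n ℂ) :=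
    { smul := fun w p => act ℂ w.1 p
      one_smul := fun p => act_one p
      mul_smul := fun v w p => act_mul v.1 w.1 p
      smul_zero := fun w => map_zero (act ℂ w.1)
      smul_add := fun w p q => map_add (act ℂ w.1) p q
      smul_one := fun w => map_one (act ℂ w.1)
      smul_mul := fun w p q => map_mul (act ℂ w.1) p q }
  have : Algebra.IsInvariant (invariants ℂ W) (Poly n ℂ) W :=
    ⟨fun p hp => ⟨⟨p, fun w hw => hp ⟨w, hw⟩⟩, rfl⟩⟩
  exact Algebra.IsInvariant.isIntegral (invariants ℂ W) (Poly n ℂ) W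

/-- All polynomials are integral over the invariants, so f and the variables are both transcendence
bases. -/
theorem card_eq_of_adjoin_eq_invariants [Fintype W] (hind : AlgebraicIndependent ℂ f)
    (hadj : Algebra.adjoin ℂ (Set.range f) = invariants ℂ W) : Fintype.card ι = n := by
  have h1 : IsTranscendenceBasis ℂ f := by
    rw [hind.isTranscendenceBasis_iff_isAlgebraic, hadj]
    have := isIntegral_invariants (W := W)
    infer_instance
  simpa using h1.cardinalMk_eq (IsTranscendenceBasis.mvPolynomial (Fin n) ℂ)

/-- The theorem of Chevalley: the invariants of a finite reflection group have a system of
homogeneous basic invariants. -/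
theorem exists_isDegreeSequence [Fintype W] (hW : IsReflectionGroup W) :
    ∃ d : Fin n → ℕ, IsDegreeSequence W d := by
  classical
  obtain ⟨T, hT, hspan⟩ := Submodule.fg_span_iff_fg_span_finset_subset (R := Poly n ℂ)
    {p : Poly n ℂ | p ∈ invariants ℂ W ∧ ∃ m, m ≠ 0 ∧ p.IsHomogeneous m} |>.mp
    (IsNoetherian.noetherian _)
  obtain ⟨J, hJ, hmin⟩ := exists_minimal_generators (fun p : T => (p : Poly n ℂ))
  let f : J → Poly n ℂ := fun j => j.1.1
  have hf : ∀ j, f j ∈ invariants ℂ W := fun j => (hT j.1.2).1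
  choose d hd0 hd using fun j : J => (hT j.1.2).2
  have hfspan : Ideal.span (Set.range f) = invariantIdeal W := by
    have h1 : Set.range f = (fun p : T => (p : Poly n ℂ)) '' J := by
      ext x
      simp [f]
    rw [h1, hJ, Subtype.range_coe_subtype]
    exact hspan.symm
  have hfmin : ∀ j, f j ∉ Ideal.span (f '' {i | i ≠ j}) := by
    intro j hj
    refine hmin j.1 j.2 (Ideal.span_mono ?_ hj)
    rintro _ ⟨i, hi, rfl⟩
    exact ⟨i.1, ⟨i.2, fun h => hi (Subtype.ext h)⟩, rfl⟩
  have hind := algebraicIndependent_of_minimal hW hf hd hd0 hfspan hfmin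
  have hadj := adjoin_eq_invariants hf hd hd0 hfspan
  have hcard := card_eq_of_adjoin_eq_invariants hind hadj
  -- The generators are renumbered by `Fin n` and then sorted by degree.
  let φ : Fin n ≃ J := (Fintype.equivFinOfCardEq hcard).symm
  let ψ : Fin n ≃ J := (Tuple.sort (d ∘ φ)).trans φ
  refine ⟨d ∘ ψ, Tuple.monotone_sort (d ∘ φ), f ∘ ψ, fun i => hd _,
    hind.comp ψ ψ.injective, ?_⟩
  rw [ψ.surjective.range_comp, hadj]

end Chevalley

/-! ### Homogeneous invariants and decomposable invariants -/

section GradedInvariants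

variable {n : ℕ} (W : Subgroup (OrthGroup n))

/-- The space of homogeneous invariants of degree `m`. -/
def gradedInvariants (m : ℕ) : Submodule ℂ (Poly n ℂ) :=
  Subalgebra.toSubmodule (invariants ℂ W) ⊓ homogeneousSubmodule (Fin n) ℂ m

/-- The span of the products of two homogeneous invariants of positive degree, of total
degree `m`. -/
def decomposables (m : ℕ) : Submodule ℂ (Poly n ℂ) :=
  Submodule.span ℂ {r | ∃ k l, k ≠ 0 ∧ l ≠ 0 ∧ k + l = m ∧
    ∃ p ∈ gradedInvariants W k, ∃ q ∈ gradedInvariants W l, p * q = r}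

variable {W}

theorem decomposables_le (m : ℕ) : decomposables W m ≤ gradedInvariants W m := by
  rw [decomposables, Submodule.span_le]
  rintro _ ⟨k, l, -, -, rfl, p, hp, q, hq, rfl⟩
  exact ⟨Subalgebra.mul_mem (invariants ℂ W) hp.1 hq.1, IsHomogeneous.mul hp.2 hq.2⟩

instance finite_homogeneousSubmodule (m : ℕ) :
    FiniteDimensional ℂ (homogeneousSubmodule (Fin n) ℂ m) :=
  Module.Finite.iff_fg.mpr (homogeneousSubmodule_fg (Fin n) ℂ m)

instance finite_gradedInvariants (m : ℕ) : FiniteDimensional ℂ (gradedInvariants W m) :=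
  Submodule.finiteDimensional_of_le (inf_le_right : _ ≤ homogeneousSubmodule (Fin n) ℂ m)

instance finite_decomposables (m : ℕ) : FiniteDimensional ℂ (decomposables W m) :=
  Submodule.finiteDimensional_of_le (decomposables_le m)

theorem conj_mem_gradedInvariants {m : ℕ} {p : Poly n ℂ} (hp : p ∈ gradedInvariants W m) :
    map (starRingEnd ℂ) p ∈ gradedInvariants W m :=
  ⟨map_mem_invariants _ (fun r => by simp [realTo]) hp.1, IsHomogeneous.map hp.2 _⟩

theorem conj_mem_decomposables {m : ℕ} {p : Poly n ℂ} (hp : p ∈ decomposables W m) :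
    map (starRingEnd ℂ) p ∈ decomposables W m := by
  induction hp using Submodule.span_induction with
  | mem x hx =>
    obtain ⟨k, l, hk, hl, hkl, p, hp, q, hq, rfl⟩ := hx
    rw [map_mul]
    exact Submodule.subset_span ⟨k, l, hk, hl, hkl, _, conj_mem_gradedInvariants hp, _,
      conj_mem_gradedInvariants hq, rfl⟩
  | zero => simp
  | add x y _ _ hx hy =>
    rw [map_add]
    exact add_mem hx hy
  | smul a x _ hx =>
    rw [smul_eq_C_mul, map_mul, map_C, ← smul_eq_C_mul]
    exact Submodule.smul_mem _ _ hx

theorem isHomogeneous_of_mem_extendScalars {R : Type} [CommRing R] [Algebra ℂ R] {m : ℕ}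
    {x : Poly n R} (hx : x ∈ extendScalars R (gradedInvariants W m)) :
    x ∈ invariants R W ∧ x.IsHomogeneous m := by
  have h : extendScalars R (gradedInvariants W m)
      ≤ Subalgebra.toSubmodule (invariants R W) ⊓ homogeneousSubmodule (Fin n) R m := by
    rw [extendScalars, Submodule.span_le]
    rintro _ ⟨p, hp, rfl⟩
    exact ⟨map_mem_invariants _ (fun r => by simp [realTo]) hp.1, IsHomogeneous.map hp.2 _⟩
  exact h hx

/-- An invariant is its own average, and averages of monomials are defined over ℂ. -/
theorem mem_extendScalars_of_invariant [Fintype W] {R : Type} [CommRing R] [Algebra ℂ R] {m : ℕ}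
    {x : Poly n R} (hx : x ∈ invariants R W) (hm : x.IsHomogeneous m) :
    x ∈ extendScalars R (gradedInvariants W m) := by
  rw [← reynolds_of_mem hx, x.as_sum, map_sum]
  refine Submodule.sum_mem _ fun a ha => ?_
  have h1 : monomial a (coeff a x) = coeff a x • map (algebraMap ℂ R) (monomial a 1) := by
    rw [map_monomial, map_one, smul_monomial, smul_eq_mul, mul_one]
  have h2 : reynolds R W (map (algebraMap ℂ R) (monomial a 1))
      = map (algebraMap ℂ R) (reynolds ℂ W (monomial a 1)) := by
    rw [reynolds_apply, reynolds_apply, map_algebraMap_smul, map_sum]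
    congr 1
    exact Finset.sum_congr rfl fun w _ => (map_act _ (fun r => by simp [realTo]) _ _).symm
  rw [h1, map_smul, h2]
  refine Submodule.smul_mem _ _ (map_mem_extendScalars ⟨reynolds_mem _,
    isHomogeneous_reynolds (isHomogeneous_monomial _ ?_)⟩)
  rw [← hm (mem_support_iff.mp ha), Finsupp.degree_eq_weight_one]
  rfl

end GradedInvariants

/-! ### Quasiharmonic invariants as the orthogonal complement of the decomposables -/

section Quasiharmonic

variable {n : ℕ} {W : Subgroup (OrthGroup n)} {R : Type} [CommRing R] [Algebra ℂ R] [IsDomain R]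

theorem pairing_eq_zero_of_quasiharmonic [Fintype (Refl W)] {c : ReflClass W → R} {m : ℕ}
    {x : Poly n R} (hx : x ∈ quasiharmonic c m) {p : Poly n ℂ} (hp : p ∈ decomposables W m) :
    pairing c p x = 0 := by
  induction hp using Submodule.span_induction with
  | mem p hp =>
    obtain ⟨k, l, hk, hl, hkl, p, hp, q, hq, rfl⟩ := hp
    rw [pairing_mul, hx l (by omega) (by omega) q hq.1 hq.2, map_zero]
  | zero => rw [pairing_apply, dunklPoly_zero, LinearMap.zero_apply, map_zero]
  | add p q _ _ hp hq =>
    rw [pairing_apply] at hp hq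
    rw [pairing_apply, dunklPoly_add, LinearMap.add_apply, map_add, hp, hq, add_zero]
  | smul a p _ hp => rw [pairing_smul, hp, mul_zero]

/-- By adjointness ∇_p x is orthogonal to all invariants of degree m - k. It is itself such an
invariant over R, so nondegeneracy makes it zero. -/
theorem quasiharmonic_of_pairing_eq_zero [Fintype W] [Fintype (Refl W)] (ε : R →ₐ[ℂ] ℂ)
    {c : ReflClass W → R} (hc : ∀ C, ε (c C) = 0) {m : ℕ} {x : Poly n R}
    (hx : x ∈ invariants R W) (hm : x.IsHomogeneous m)
    (h : ∀ p ∈ decomposables W m, pairing c p x = 0) : x ∈ quasiharmonic c m := by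
  intro k hk0 hkm p hp hpk
  refine eq_zero_of_pairing_eq_zero ε hc (gradedInvariants W (m - k))
    (fun _ => conj_mem_gradedInvariants) (mem_extendScalars_of_invariant
      (dunklPoly_mem_invariants c hp hx) (dunklPoly_isHomogeneous c hpk hm)) fun q hq => ?_
  rw [← pairing_mul]
  exact h _ (Submodule.subset_span ⟨m - k, k, by omega, by omega, by omega, q, hq, p, ⟨hp, hpk⟩,
    rfl⟩)

end Quasiharmonic

/-! ### Extension of scalars for linear forms -/

section ExtendForm

variable {n : ℕ} (R : Type) [CommRing R] [Algebra ℂ R]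

/-- The extension of scalars of a linear form on `S(V)`. -/
def extendForm (l : Poly n ℂ →ₗ[ℂ] ℂ) : Poly n R →ₗ[R] R :=
  (basisMonomials (Fin n) R).constr R fun a => algebraMap ℂ R (l (monomial a 1))

variable {R}

theorem extendForm_monomial (l : Poly n ℂ →ₗ[ℂ] ℂ) (a : Fin n →₀ ℕ) (r : R) :
    extendForm R l (monomial a r) = r * algebraMap ℂ R (l (monomial a 1)) := by
  have h : monomial a r = r • basisMonomials (Fin n) R a := by
    rw [coe_basisMonomials, smul_monomial, smul_eq_mul, mul_one]
  rw [h, map_smul, extendForm, Module.Basis.constr_basis, smul_eq_mul]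

theorem apply_monomial (l : Poly n ℂ →ₗ[ℂ] ℂ) (a : Fin n →₀ ℕ) (r : ℂ) :
    l (monomial a r) = r * l (monomial a 1) := by
  rw [← smul_eq_mul, ← map_smul, smul_monomial, smul_eq_mul, mul_one]

theorem extendForm_map (l : Poly n ℂ →ₗ[ℂ] ℂ) (p : Poly n ℂ) :
    extendForm R l (map (algebraMap ℂ R) p) = algebraMap ℂ R (l p) := by
  rw [p.as_sum]
  simp only [map_sum, map_monomial, extendForm_monomial]
  refine Finset.sum_congr rfl fun a _ => ?_
  rw [apply_monomial l a (coeff a p), map_mul]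

theorem apply_extendForm (ε : R →ₐ[ℂ] ℂ) (l : Poly n ℂ →ₗ[ℂ] ℂ) (x : Poly n R) :
    ε (extendForm R l x) = l (map (ε : R →+* ℂ) x) := by
  rw [x.as_sum]
  simp only [map_sum, map_monomial, extendForm_monomial]
  refine Finset.sum_congr rfl fun a _ => ?_
  rw [apply_monomial l a ((ε : R →+* ℂ) (coeff a x)), map_mul, AlgHom.commutes]
  rfl

end ExtendForm

/-- A surjective endomorphism of a Noetherian ring is injective. -/
theorem injective_of_surjective_ringHom {A : Type*} [CommRing A] [IsNoetherianRing A]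
    (φ : A →+* A) (hφ : Function.Surjective φ) : Function.Injective φ := by
  have hker : ∀ m x, x ∈ RingHom.ker (φ ^ m) ↔ φ^[m] x = 0 := fun m x => by
    rw [RingHom.mem_ker, RingHom.coe_pow]
  obtain ⟨m, hm⟩ := monotone_stabilizes_iff_noetherian.mpr (inferInstanceAs (IsNoetherian A A))
    ⟨fun m => RingHom.ker (φ ^ m), monotone_nat_of_le_succ fun m x hx => by
      rw [hker] at hx ⊢
      rw [Function.iterate_succ_apply', hx, map_zero]⟩
  rw [injective_iff_map_eq_zero]
  intro x hx
  obtain ⟨y, rfl⟩ := (hφ.iterate m) x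
  have h1 : y ∈ RingHom.ker (φ ^ (m + 1)) := by
    rw [hker, Function.iterate_succ_apply', hx]
  have h2 : RingHom.ker (φ ^ m) = RingHom.ker (φ ^ (m + 1)) := hm (m + 1) m.le_succ
  rwa [← h2, hker] at h1

/-! ### Linear coefficients and a criterion for basic invariants -/

section BasicSystem

variable {n : ℕ} {W : Subgroup (OrthGroup n)} {f : Fin n → Poly n ℂ} {d : Fin n → ℕ}

theorem IsBasicSystem.mem (hf : IsBasicSystem W f) (i : Fin n) : f i ∈ invariants ℂ W := by
  rw [← hf.2]
  exact Algebra.subset_adjoin ⟨i, rfl⟩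

theorem IsBasicSystem.exists_aeval_eq (hf : IsBasicSystem W f) {q : Poly n ℂ}
    (hq : q ∈ invariants ℂ W) : ∃ P : MvPolynomial (Fin n) ℂ, aeval f P = q := by
  rw [← hf.2, Algebra.adjoin_range_eq_range_aeval] at hq
  exact hq

theorem IsBasicSystem.degree_ne_zero (hf : IsBasicSystem W f)
    (hd : ∀ i, (f i).IsHomogeneous (d i)) (i : Fin n) : d i ≠ 0 := by
  intro h0
  have h1 := hd i
  rw [h0] at h1
  have h2 := algebraicIndependent_iff.mp hf.1 (X i - C (constantCoeff (f i))) (by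
    rw [map_sub, aeval_X, aeval_C, algebraMap_eq, ← isHomogeneous_zero_eq_C h1, sub_self])
  have h3 := congrArg (coeff (Finsupp.single i 1)) h2
  simp [coeff_C, Finsupp.single_eq_zero, eq_comm] at h3

variable (f) in
/-- Linear forms on `S(V)` which on the polynomials in `f₁, …, fₙ` are the coefficients of
`f₁, …, fₙ`. -/
def IsLinearCoeff (l : Fin n → Poly n ℂ →ₗ[ℂ] ℂ) : Prop :=
  ∀ j P, l j (aeval f P) = coeff (Finsupp.single j 1) P

/-- Any linear left inverse of the injective map P ↦ P(f) will do; the values outside ℂ[f] are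
arbitrary. -/
theorem exists_isLinearCoeff (hf : AlgebraicIndependent ℂ f) :
    ∃ l : Fin n → Poly n ℂ →ₗ[ℂ] ℂ, IsLinearCoeff f l := by
  obtain ⟨g, hg⟩ := LinearMap.exists_leftInverse_of_injective
    ((aeval f : MvPolynomial (Fin n) ℂ →ₐ[ℂ] Poly n ℂ).toLinearMap)
    (LinearMap.ker_eq_bot.mpr hf)
  refine ⟨fun j => (lcoeff ℂ (Finsupp.single j 1)).comp g, fun j P => ?_⟩
  have := LinearMap.congr_fun hg P
  simp only [LinearMap.comp_apply, AlgHom.toLinearMap_apply, LinearMap.id_apply] at this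
  rw [LinearMap.comp_apply, this]
  rfl

variable {l : Fin n → Poly n ℂ →ₗ[ℂ] ℂ}

theorem IsLinearCoeff.apply_self (hl : IsLinearCoeff f l) (i j : Fin n) :
    l j (f i) = if i = j then 1 else 0 := by
  classical
  have := hl j (X i)
  rw [aeval_X] at this
  rw [this, coeff_X]
  simp only [Finsupp.single_left_inj one_ne_zero]

theorem coeff_single_mul_eq_zero {P Q : MvPolynomial (Fin n) ℂ} (hP : coeff 0 P = 0)
    (hQ : coeff 0 Q = 0) (j : Fin n) : coeff (Finsupp.single j 1) (P * Q) = 0 := by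
  classical
  rw [coeff_mul]
  refine Finset.sum_eq_zero fun x hx => ?_
  have h := congrArg Finsupp.degree (Finset.HasAntidiagonal.mem_antidiagonal.mp hx)
  rw [map_add, Finsupp.degree_single] at h
  rcases Nat.eq_zero_or_pos x.1.degree with h1 | h1
  · rw [(Finsupp.degree_eq_zero_iff _).mp h1, hP, zero_mul]
  · rw [(Finsupp.degree_eq_zero_iff x.2).mp (by omega), hQ, mul_zero]

theorem constantCoeff_aeval (hf : ∀ i, constantCoeff (f i) = 0) (P : MvPolynomial (Fin n) ℂ) :
    constantCoeff (aeval f P) = constantCoeff P := by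
  induction P using MvPolynomial.induction_on with
  | C a => simp [algebraMap_eq]
  | add p q hp hq => simp only [map_add, hp, hq]
  | mul_X p i _ => simp [hf]

variable (hf : IsBasicSystem W f) (hd : ∀ i, (f i).IsHomogeneous (d i)) (hl : IsLinearCoeff f l)

include hf hd hl

theorem apply_eq_zero_of_mem_decomposables {m : ℕ} {q : Poly n ℂ} (hq : q ∈ decomposables W m)
    (j : Fin n) : l j q = 0 := by
  have hf0 : ∀ i, constantCoeff (f i) = 0 := fun i =>
    constantCoeff_eq_zero_of_isHomogeneous (hd i) (hf.degree_ne_zero hd i)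
  induction hq using Submodule.span_induction with
  | mem x hx =>
    obtain ⟨k, m, hk, hm, -, p, hp, q, hq, rfl⟩ := hx
    obtain ⟨P, rfl⟩ := hf.exists_aeval_eq hp.1
    obtain ⟨Q, rfl⟩ := hf.exists_aeval_eq hq.1
    rw [← map_mul, hl]
    refine coeff_single_mul_eq_zero ?_ ?_ j
    · rw [← constantCoeff_eq, ← constantCoeff_aeval hf0]
      exact constantCoeff_eq_zero_of_isHomogeneous hp.2 hk
    · rw [← constantCoeff_eq, ← constantCoeff_aeval hf0]
      exact constantCoeff_eq_zero_of_isHomogeneous hq.2 hm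
  | zero => exact map_zero _
  | add x y _ _ hx hy => rw [map_add, hx, hy, add_zero]
  | smul a x _ hx => rw [map_smul, hx, smul_zero]

theorem mem_decomposables {m : ℕ} (hm : m ≠ 0) {q : Poly n ℂ} (hq : q ∈ gradedInvariants W m)
    (h : ∀ j, d j = m → l j q = 0) : q ∈ decomposables W m := by
  obtain ⟨P, hP⟩ := hf.exists_aeval_eq hq.1
  have h1 : aeval f (weightedHomogeneousComponent d m P) = q := by
    rw [← homogeneousComponent_aeval hd, hP, homogeneousComponent_eq_self hq.2]
  have hwt := weightedHomogeneousComponent_isWeightedHomogeneous (w := d) m P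
  generalize weightedHomogeneousComponent d m P = Q at h1 hwt
  have hmon : ∀ (b : Fin n →₀ ℕ), aeval f (monomial b (1 : ℂ))
      ∈ gradedInvariants W (Finsupp.weight d b) := fun b =>
    ⟨aeval_mem_invariants hf.mem _, isHomogeneous_aeval hd
      (isWeightedHomogeneous_monomial d b _ rfl)⟩
  rw [← h1, Q.as_sum, map_sum]
  refine Submodule.sum_mem _ fun a ha => ?_
  have haw := hwt (mem_support_iff.mp ha)
  obtain ⟨j, hj⟩ : ∃ j, a j ≠ 0 := by
    by_contra! h0
    have : a = 0 := Finsupp.ext h0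
    rw [this, map_zero] at haw
    exact hm haw.symm
  obtain ⟨b, rfl⟩ : ∃ b, a = b + Finsupp.single j 1 :=
    ⟨a - Finsupp.single j 1, (tsub_add_cancel_of_le (by
      simpa [Nat.one_le_iff_ne_zero] using hj)).symm⟩
  rw [map_add, Finsupp.weight_single, one_smul] at haw
  -- All degrees being positive, a cofactor of weight zero is trivial. The monomial is then f_j
  -- itself with d_j = m, whose coefficient vanishes by `h`.
  have hb : Finsupp.weight d b ≠ 0 := by
    intro hb
    have hdj : d j = m := by omega
    have hb0 : b = 0 := by
      ext i
      by_contra hi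
      have := Finsupp.le_weight d (hf.degree_ne_zero hd i) b
      simp only [Finsupp.coe_zero, Pi.zero_apply] at hi
      omega
    have h2 := h j hdj
    rw [← h1, hl] at h2
    rw [hb0, zero_add] at ha
    exact mem_support_iff.mp ha h2
  have h3 : monomial (b + Finsupp.single j 1) (coeff (b + Finsupp.single j 1) Q)
      = coeff (b + Finsupp.single j 1) Q • (monomial b 1 * X j) := by
    rw [X, monomial_mul, smul_monomial]
    simp
  rw [h3, map_smul, map_mul, aeval_X]
  exact Submodule.smul_mem _ _ (Submodule.subset_span ⟨_, _, hb, hf.degree_ne_zero hd j, haw, _,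
    hmon b, _, ⟨hf.mem j, hd j⟩, rfl⟩)

theorem sub_sum_mem_decomposables {m : ℕ} (hm : m ≠ 0) {q : Poly n ℂ}
    (hq : q ∈ gradedInvariants W m) :
    q - ∑ j with d j = m, l j q • f j ∈ decomposables W m := by
  refine mem_decomposables hf hd hl hm (sub_mem hq (Submodule.sum_mem _ fun j hj =>
    Submodule.smul_mem _ _ ⟨hf.mem j, (Finset.mem_filter.mp hj).2 ▸ hd j⟩)) fun j hj => ?_
  simp [hl.apply_self, hj]

theorem extendForm_eq_zero {R : Type} [CommRing R] [Algebra ℂ R] {m : ℕ} {x : Poly n R}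
    (hx : x ∈ extendScalars R (decomposables W m)) (j : Fin n) : extendForm R (l j) x = 0 := by
  induction hx using Submodule.span_induction with
  | mem x hx =>
    obtain ⟨p, hp, rfl⟩ := hx
    rw [extendForm_map, apply_eq_zero_of_mem_decomposables hf hd hl hp, map_zero]
  | zero => exact map_zero _
  | add x y _ _ hx hy => rw [map_add, hx, hy, add_zero]
  | smul a x _ hx => rw [map_smul, hx, smul_zero]

theorem sub_sum_mem_extendScalars {R : Type} [CommRing R] [Algebra ℂ R] {m : ℕ} (hm : m ≠ 0)
    {x : Poly n R} (hx : x ∈ extendScalars R (gradedInvariants W m)) :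
    x - ∑ j with d j = m, extendForm R (l j) x • map (algebraMap ℂ R) (f j)
      ∈ extendScalars R (decomposables W m) := by
  induction hx using Submodule.span_induction with
  | mem x hx =>
    obtain ⟨p, hp, rfl⟩ := hx
    have := map_mem_extendScalars (R := R) (sub_sum_mem_decomposables hf hd hl hm hp)
    simpa only [map_sub, map_sum, map_algebraMap_smul, extendForm_map] using this
  | zero => simp
  | add x y _ _ hx hy =>
    convert add_mem hx hy using 1
    simp only [map_add, add_smul, Finset.sum_add_distrib]
    ring
  | smul a x _ hx =>
    convert Submodule.smul_mem _ a hx using 1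
    simp only [map_smul, smul_sub, Finset.smul_sum, smul_eq_mul, mul_smul]

theorem extendForm_eq_zero_of_ne {R : Type} [CommRing R] [Algebra ℂ R] {m : ℕ} (hm : m ≠ 0)
    {x : Poly n R} (hx : x ∈ extendScalars R (gradedInvariants W m)) {j : Fin n}
    (hj : d j ≠ m) : extendForm R (l j) x = 0 := by
  have h := extendForm_eq_zero hf hd hl (sub_sum_mem_extendScalars hf hd hl hm hx) j
  rw [map_sub, map_sum, sub_eq_zero] at h
  rw [h]
  refine Finset.sum_eq_zero fun i hi => ?_
  have hij : i ≠ j := by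
    rintro rfl
    exact hj (Finset.mem_filter.mp hi).2
  rw [map_smul, extendForm_map, hl.apply_self, if_neg hij, map_zero, smul_zero]

theorem apply_eq_zero_of_ne {m : ℕ} (hm : m ≠ 0) {q : Poly n ℂ}
    (hq : q ∈ gradedInvariants W m) {j : Fin n} (hj : d j ≠ m) : l j q = 0 := by
  have := extendForm_eq_zero_of_ne (R := ℂ) hf hd hl hm (map_mem_extendScalars hq) hj
  rwa [extendForm_map] at this

/-- Homogeneous invariants of the degrees of the group form a system of basic invariants if
the matrix of their linear coefficients is invertible. -/
theorem isBasicSystem_of_det_ne_zero {g : Fin n → Poly n ℂ}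
    (hg : ∀ i, g i ∈ gradedInvariants W (d i))
    (hdet : (Matrix.of fun i j => l j (g i)).det ≠ 0) : IsBasicSystem W g := by
  set A : Matrix (Fin n) (Fin n) ℂ := Matrix.of fun i j => l j (g i) with hA
  have hgen : ∀ (m : ℕ) (q : Poly n ℂ), q ∈ gradedInvariants W m →
      q ∈ Algebra.adjoin ℂ (Set.range g) := by
    intro m
    induction m using Nat.strong_induction_on with
    | _ m ih =>
    intro q hq
    rcases eq_or_ne m 0 with rfl | hm
    · rw [isHomogeneous_zero_eq_C hq.2]
      exact Subalgebra.algebraMap_mem _ _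
    have hdec : decomposables W m ≤ Subalgebra.toSubmodule (Algebra.adjoin ℂ (Set.range g)) := by
      rw [decomposables, Submodule.span_le]
      rintro _ ⟨k, m', hk, hm', rfl, p, hp, p', hp', rfl⟩
      exact Subalgebra.mul_mem _ (ih _ (by omega) p hp) (ih _ (by omega) p' hp')
    -- The v_i are chosen to cancel the linear part of q. Only those with d_i = m matter, as
    -- l_j(g_i) = 0 for d_i ≠ d_j.
    let v : Fin n → ℂ := Matrix.vecMul (fun j => l j q) A⁻¹
    have hv : Matrix.vecMul v A = fun j => l j q := by
      rw [Matrix.vecMul_vecMul, Matrix.nonsing_inv_mul _ (isUnit_iff_ne_zero.mpr hdet),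
        Matrix.vecMul_one]
    have h1 : q - ∑ i with d i = m, v i • g i ∈ decomposables W m := by
      refine mem_decomposables hf hd hl hm (sub_mem hq (Submodule.sum_mem _ fun i hi =>
        Submodule.smul_mem _ _ ((Finset.mem_filter.mp hi).2 ▸ hg i))) fun j hj => ?_
      rw [map_sub, map_sum, sub_eq_zero]
      refine (congrFun hv j).symm.trans ?_
      rw [Finset.sum_filter]
      change ∑ i, v i * A i j = _
      refine Finset.sum_congr rfl fun i _ => ?_
      split_ifs with hi
      · rw [map_smul]
        rfl
      · have : l j (g i) = 0 := apply_eq_zero_of_ne hf hd hl (hf.degree_ne_zero hd i) (hg i)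
          fun h => hi (h ▸ hj)
        simp [hA, this]
    have h2 : ∑ i with d i = m, v i • g i ∈ Algebra.adjoin ℂ (Set.range g) :=
      Subalgebra.sum_mem _ fun i _ =>
        Subalgebra.smul_mem _ (Algebra.subset_adjoin (Set.mem_range_self i)) _
    have h3 := Subalgebra.add_mem _ (hdec h1) h2
    rwa [sub_add_cancel] at h3
  have hadj : Algebra.adjoin ℂ (Set.range g) = invariants ℂ W := by
    refine le_antisymm (Algebra.adjoin_le (by rintro _ ⟨i, rfl⟩; exact (hg i).1)) fun q hq => ?_
    rw [← sum_homogeneousComponent q]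
    exact Subalgebra.sum_mem _ fun m _ => hgen m _ ⟨homogeneousComponent_mem_invariants hq m,
      homogeneousComponent_isHomogeneous m q⟩
  refine ⟨?_, hadj⟩
  choose P hP using fun i => hf.exists_aeval_eq (hg i).1
  -- Writing g = P(f), the substitution P is surjective since g generates the invariants; so it is
  -- injective, which is the independence of g.
  let φ : MvPolynomial (Fin n) ℂ →ₐ[ℂ] MvPolynomial (Fin n) ℂ := aeval P
  have hφ : ∀ Q, aeval f (φ Q) = aeval g Q := fun Q => by
    rw [comp_aeval_apply]
    simp only [hP]
  have hsurj : Function.Surjective φ := by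
    intro Q
    have hQ : aeval f Q ∈ Algebra.adjoin ℂ (Set.range g) := by
      rw [hadj]
      exact aeval_mem_invariants hf.mem Q
    rw [Algebra.adjoin_range_eq_range_aeval] at hQ
    obtain ⟨Q', hQ'⟩ := hQ
    exact ⟨Q', hf.1 ((hφ Q').trans hQ')⟩
  have hinj := injective_of_surjective_ringHom φ.toRingHom hsurj
  intro Q Q' h
  rw [← hφ, ← hφ] at h
  exact hinj (hf.1 h)

end BasicSystem

/-! ### Canonical deformed invariants: existence and generic specialization -/

section Canonical

variable {n : ℕ} {W : Subgroup (OrthGroup n)} {f : Fin n → Poly n ℂ} {d : Fin n → ℕ}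

theorem exists_eval_univParam_eq_zero :
    ∃ ε : ParamRing W →ₐ[ℂ] ℂ, ∀ C, ε (univParam W C) = 0 :=
  ⟨aeval fun _ => 0, fun C => by rw [univParam, aeval_X]⟩

/-- The projection of f_i away from the decomposables, times a Gram determinant, is quasiharmonic.
The subtracted part has no linear coefficients, so their matrix is diagonal with nonzero entries,
whence linear independence. -/
theorem exists_isCanonicalSystem [Fintype W] [Fintype (Refl W)] (hf : IsBasicSystem W f)
    (hd : ∀ i, (f i).IsHomogeneous (d i)) :
    ∃ e : Fin n → Poly n (ParamRing W), IsCanonicalSystem W d e := by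
  obtain ⟨ε, hε⟩ := exists_eval_univParam_eq_zero (W := W)
  obtain ⟨l, hl⟩ := exists_isLinearCoeff hf.1
  choose D hD0 hD using fun m => exists_pairing_sub_eq_zero ε hε (decomposables W m)
    fun _ => conj_mem_decomposables
  choose y hy hpair using fun i => hD (d i) (map (algebraMap ℂ (ParamRing W)) (f i))
  have hmem : ∀ i, D (d i) • map (algebraMap ℂ (ParamRing W)) (f i) - y i
      ∈ extendScalars (ParamRing W) (gradedInvariants W (d i)) := fun i =>
    sub_mem (Submodule.smul_mem _ _ (map_mem_extendScalars ⟨hf.mem i, hd i⟩))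
      (Submodule.span_mono (Set.image_mono (decomposables_le (d i))) (hy i))
  refine ⟨fun i => D (d i) • map (algebraMap ℂ (ParamRing W)) (f i) - y i, fun i => ?_, ?_⟩
  · have h := isHomogeneous_of_mem_extendScalars (hmem i)
    exact ⟨h.1, h.2, quasiharmonic_of_pairing_eq_zero ε hε h.1 h.2 (hpair i)⟩
  · rw [Fintype.linearIndependent_iff]
    intro r hr j
    have h := congrArg (extendForm (ParamRing W) (l j)) hr
    simp only [map_sum, map_smul, map_sub, map_zero, extendForm_map, hl.apply_self,
      extendForm_eq_zero hf hd hl (hy _) j, sub_zero, smul_eq_mul] at h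
    rw [Finset.sum_eq_single j] at h
    · simpa [hD0] using h
    · intro i _ hij
      simp [hij]
    · simp

theorem det_extendForm_ne_zero [Fintype W] [Fintype (Refl W)] (hf : IsBasicSystem W f)
    (hd : ∀ i, (f i).IsHomogeneous (d i)) {l : Fin n → Poly n ℂ →ₗ[ℂ] ℂ}
    (hl : IsLinearCoeff f l) {e : Fin n → Poly n (ParamRing W)} (he : IsCanonicalSystem W d e) :
    (Matrix.of fun i j => extendForm (ParamRing W) (l j) (e i)).det ≠ 0 := by
  intro hdet
  obtain ⟨ε, hε⟩ := exists_eval_univParam_eq_zero (W := W)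
  obtain ⟨b, hb, hb0⟩ := Matrix.exists_vecMul_eq_zero_iff.mpr hdet
  obtain ⟨i₀, hi₀⟩ := Function.ne_iff.mp hb
  have hgr : ∀ i, e i ∈ extendScalars (ParamRing W) (gradedInvariants W (d i)) := fun i =>
    mem_extendScalars_of_invariant (he.1 i).1 (he.1 i).2.1
  have hm := hf.degree_ne_zero hd i₀
  generalize hm' : d i₀ = m at hm
  -- The matrix is block diagonal by degree, so the block of a null vector containing i₀ is again a
  -- null vector, now giving a homogeneous combination.
  let x := ∑ i with d i = m, b i • e i
  have hx : x ∈ extendScalars (ParamRing W) (gradedInvariants W m) :=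
    Submodule.sum_mem _ fun i hi =>
      Submodule.smul_mem _ _ ((Finset.mem_filter.mp hi).2 ▸ hgr i)
  have hxq : x ∈ quasiharmonic (univParam W) m :=
    Submodule.sum_mem _ fun i hi =>
      Submodule.smul_mem _ _ ((Finset.mem_filter.mp hi).2 ▸ (he.1 i).2.2)
  have hform : ∀ j, d j = m → extendForm (ParamRing W) (l j) x = 0 := by
    intro j hj
    refine Eq.trans ?_ (congrFun hb0 j)
    simp only [x, map_sum, map_smul]
    rw [Finset.sum_filter]
    refine Finset.sum_congr rfl fun i _ => ?_
    split_ifs with hi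
    · rfl
    · have := extendForm_eq_zero_of_ne hf hd hl (hf.degree_ne_zero hd i) (hgr i) (j := j)
        fun h => hi (h ▸ hj)
      simp [this]
  have hxd : x ∈ extendScalars (ParamRing W) (decomposables W m) := by
    have h := sub_sum_mem_extendScalars hf hd hl hm hx
    rwa [Finset.sum_eq_zero, sub_zero] at h
    intro j hj
    rw [hform j (Finset.mem_filter.mp hj).2, zero_smul]
  have hx0 : x = 0 := eq_zero_of_pairing_eq_zero ε hε (decomposables W m)
    (fun _ => conj_mem_decomposables) hxd fun p => pairing_eq_zero_of_quasiharmonic hxq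
  have h1 : ∑ i, (if d i = m then b i else 0) • e i = 0 := by
    rw [← hx0]
    simp only [x]
    rw [Finset.sum_filter]
    exact Finset.sum_congr rfl fun i _ => by split_ifs <;> simp
  have h2 := Fintype.linearIndependent_iff.mp he.2 _ h1 i₀
  rw [if_pos hm'] at h2
  exact hi₀ h2

/-- Taking linear coefficients commutes with specialization, so the specialized determinant is that
of the specialized elements. -/
theorem isBasicSystem_specialize (hf : IsBasicSystem W f) (hd : ∀ i, (f i).IsHomogeneous (d i))
    {l : Fin n → Poly n ℂ →ₗ[ℂ] ℂ} (hl : IsLinearCoeff f l)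
    {e : Fin n → Poly n (ParamRing W)} (he : IsCanonicalSystem W d e) {c : ReflClass W → ℂ}
    (hc : eval c (Matrix.of fun i j => extendForm (ParamRing W) (l j) (e i)).det ≠ 0) :
    IsBasicSystem W fun i => specialize W c (e i) := by
  refine isBasicSystem_of_det_ne_zero hf hd hl (fun i => ⟨map_mem_invariants _
    (fun r => ?_) (he.1 i).1, IsHomogeneous.map (he.1 i).2.1 _⟩) ?_
  · exact eval_C _
  · rw [RingHom.map_det] at hc
    convert hc using 2
    ext i j
    exact (apply_extendForm (aeval c : ParamRing W →ₐ[ℂ] ℂ) (l j) (e i)).symm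

end Canonical

end DeformedInvariants

end

theorem mainTheorem2 (n : ℕ) (W : Subgroup (DeformedInvariants.OrthGroup n))
    (hfin : Finite W) (hrefl : DeformedInvariants.IsReflectionGroup W)
    (hirr : DeformedInvariants.IsIrreducibleGroup W) :
    (∃ d : Fin n → ℕ, DeformedInvariants.IsDegreeSequence W d) ∧
    ∀ d : Fin n → ℕ, DeformedInvariants.IsDegreeSequence W d →
      (∃ e : Fin n → DeformedInvariants.Poly n (DeformedInvariants.ParamRing W),
        DeformedInvariants.IsCanonicalSystem W d e) ∧
      ∀ e : Fin n → DeformedInvariants.Poly n (DeformedInvariants.ParamRing W),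
        DeformedInvariants.IsCanonicalSystem W d e →
        ∃ F : DeformedInvariants.ParamRing W, F ≠ 0 ∧
          ∀ c : DeformedInvariants.ReflClass W → ℂ, MvPolynomial.eval c F ≠ 0 →
            DeformedInvariants.IsBasicSystem W
              (fun i => DeformedInvariants.specialize W c (e i)) := by
  have : Fintype W := Fintype.ofFinite W
  have : Fintype (DeformedInvariants.Refl W) := Fintype.ofFinite _
  refine ⟨DeformedInvariants.exists_isDegreeSequence hrefl, ?_⟩
  rintro d ⟨-, f, hd, hf⟩
  refine ⟨DeformedInvariants.exists_isCanonicalSystem hf hd, fun e he => ?_⟩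
  obtain ⟨l, hl⟩ := DeformedInvariants.exists_isLinearCoeff hf.1
  exact ⟨_, DeformedInvariants.det_extendForm_ne_zero hf hd hl he, fun c hc =>
    DeformedInvariants.isBasicSystem_specialize hf hd hl he hc⟩
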